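/- **Lemma (The Injectivity Lemma).** Let $\mathcal G\subseteq\mathbb C$ be a domain, $\phi:\mathcal G\to\mathcal G$ holomorphic with $\phi'(\xi)\ne 0$ for all $\xi\in\mathcal G$, and let $\xi_0\in\mathcal G$ satisfy $\phi(\xi_0)=\xi_0$ and $0<\phi'(\xi_0)<1$. Let $\mathcal A_0$ be the immediate basin of $\xi_0$, i.e. the connected component containing $\xi_0$ of $\{\xi\in\mathcal G:\phi^{\circ n}(\xi)\to\xi_0\}$. For $\xi\in\mathcal A_0$ put $$\vartheta(w,\xi)=\sum_{n=0}^\infty \phi^{\circ (n+1)}(\xi)\frac{w^n}{n!},\qquad \phi^{\circ z}(\xi)=\frac{d^{z-1}}{dw^{z-1}}\Big|_{w=0}\vartheta(w,\xi)\quad(\Re z>0),$$ where for an entire function $f$ the differintegral $\frac{d^{s}}{dw^{s}}\big|_{w=0}f$ is the analytic continuation to $\Re s>-1$ of $\frac1{\Gamma(-s)}\int_0^\infty f(-y)\,y^{-s-1}\,dy$ (for $-1<\Re s<0$), namely $$\frac{d^{s}}{dw^{s}}\Big|_{w=0}f=\frac{1}{\Gamma(-s)}\left(\sum_{n=0}^\infty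 \frac{f^{(n)}(0)(-1)^n}{n!\,(n-s)}+\int_1^\infty f(-y)\,y^{-s-1}\,dy\right),$$ with the value $f^{(m)}(0)$ at $s=m\in\{0,1,2,\dots\}$. Let $\mathcal D\subseteq\mathcal A_0$ be the set of $\xi\in\mathcal A_0$ at which this fractional iteration is defined as a map into $\mathcal A_0$: there is $\theta>0$ such that $\vartheta(\cdot,\xi)$ is entire with $\int_0^\infty|\vartheta(-e^{i\eta}x,\xi)|\,dx<\infty$ for all $|\eta|<\theta$, and $\phi^{\circ z}(\xi)\in\mathcal A_0$ for all $\Re z>0$. Then $\mathcal D$ contains a neighbourhood of $\xi_0$, and for every $\xi\in\mathcal D$ whose forward orbit does not meet $\xi_0$ (i.e. $\phi^{\circ n}(\xi)\neq\xi_0$ for all $n\ge0$), the function $z\mapsto\phi^{\circ z}(\xi)$ is injective on the half-strip $$\{z\in\mathbb C:\ \Re z>0,\ 0\le \Im z<2\pi/|\log\phi'(\xi_0)|\}.$$ -/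

import Mathlib

open Set Filter Topology MeasureTheory

noncomputable section

/-- Entire functions `f` such that `y ↦ f (-y)` is absolutely integrable along every ray
from `0` to `∞` in the open sector `|arg y| < θ`. -/
def sectorClass (θ : ℝ) : Set (ℂ → ℂ) :=
  {f | Differentiable ℂ f ∧ ∀ η : ℝ, |η| < θ →
    IntegrableOn (fun x : ℝ => f (-((x : ℂ) * Complex.exp (η * Complex.I)))) (Ioi 0)}

/-- The differintegral `d^s/dw^s f(w)` at `w = 0`, with base point `-∞`, for `-1 < Re s`.
It is the analytic continuation of `(1 / Γ(-s)) ∫_0^∞ f(-y) y^(-s-1) dy` from `-1 < Re s < 0`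
to `-1 < Re s`: the part of the integral over `[0, 1]` is written as the sum over `n` of
`f^(n)(0) (-1)^n / (n! (n - s))`. At `s = m ∈ ℕ`, where the formula has a removable
singularity, the value is `f^(m)(0)`. -/
def differintegral (f : ℂ → ℂ) (s : ℂ) : ℂ :=
  if s = (⌊s.re⌋₊ : ℂ) then iteratedDeriv ⌊s.re⌋₊ f 0
  else (Complex.Gamma (-s))⁻¹ *
    ((∑' n : ℕ, iteratedDeriv n f 0 * (-1) ^ n / ((n.factorial : ℂ) * ((n : ℂ) - s))) +
      ∫ y in Ioi (1 : ℝ), f (-(y : ℂ)) * (y : ℂ) ^ (-s - 1))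

/-- The generating function `ϑ(w, ξ) = ∑ φ^{∘(n+1)}(ξ) w^n / n!` of the natural iterates. -/
def iterTheta (φ : ℂ → ℂ) (ξ w : ℂ) : ℂ :=
  ∑' n : ℕ, φ^[n + 1] ξ * w ^ n / (n.factorial : ℂ)

/-- The fractional iterate `φ^{∘z}(ξ)`: the differintegral of order `z - 1` of `ϑ(·, ξ)` at `0`. -/
def fracIter (φ : ℂ → ℂ) (z ξ : ℂ) : ℂ :=
  differintegral (iterTheta φ ξ) (z - 1)

/-- The basin of attraction in `G` of the fixed point `ξ₀`. -/
def basin (G : Set ℂ) (φ : ℂ → ℂ) (ξ₀ : ℂ) : Set ℂ :=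
  {ξ | ξ ∈ G ∧ Tendsto (fun n : ℕ => φ^[n] ξ) atTop (𝓝 ξ₀)}

/-- The immediate basin: the connected component of the basin that contains `ξ₀`. -/
def immediateBasin (G : Set ℂ) (φ : ℂ → ℂ) (ξ₀ : ℂ) : Set ℂ :=
  connectedComponentIn (basin G φ ξ₀) ξ₀

/-- The points `ξ` of the immediate basin at which the fractional iteration is defined as a map
from the half-plane `Re z > 0` to the immediate basin: `ϑ(·, ξ)` is differintegrable in
some sector, and the iterates `φ^{∘z}(ξ)` lie in the immediate basin. -/
def fracIterDomain (G : Set ℂ) (φ : ℂ → ℂ) (ξ₀ : ℂ) : Set ℂ :=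
  {ξ | ξ ∈ immediateBasin G φ ξ₀ ∧
    (∃ θ : ℝ, 0 < θ ∧ iterTheta φ ξ ∈ sectorClass θ) ∧
    ∀ z : ℂ, 0 < z.re → fracIter φ z ξ ∈ immediateBasin G φ ξ₀}

end

noncomputable section

/-! Write λ for the multiplier at the fixed point (`l` in the code). Koenigs' theorem gives an
injective holomorphic h on a disc about 0 with h(0) = ξ₀ and φ(h(u)) = h(λu). Expanding h(λⁿc) in
powers of c turns the orbit of h(c) into Σ β_k (λᵏ)ⁿ, so ϑ is a mixture of the exponentials
exp(λᵏw). The differintegral of order s of exp(rw) at 0 is rˢ by the Gamma integral, whence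
φ^{∘z}(h(c)) = h(λᶻc). This settles the neighbourhood of ξ₀ (`fracIter_parametrization`).

For a general ξ in the domain, the orbit reaches some h(C) at a time N, and C ≠ 0 because it avoids
ξ₀. Integration by parts (`differintegral_egf_add_natCast`) gives φ^{∘(z+N)}(ξ) = h(λᶻC). Hence
φ^{∘(z+1)}(ξ) = φ(φ^{∘z}(ξ)) for large Re z, and the identity theorem extends it to Re z > 0 since
the iterates stay in G (`fracIter_add_natCast`). If the iterates at z and w agree, applying φ N
times yields h(λᶻC) = h(λʷC), so λᶻ = λʷ, and the height of the strip forces z = w. -/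

/-- The exponential generating function of a sequence. -/
def egf (a : ℕ → ℂ) (w : ℂ) : ℂ :=
  ∑' n : ℕ, a n * w ^ n / (n.factorial : ℂ)

/-- The regularized Mellin integral in the definition of `differintegral`. -/
def mellinCont (a : ℕ → ℂ) (s : ℂ) : ℂ :=
  (∑' n : ℕ, a n * (-1) ^ n / ((n.factorial : ℂ) * ((n : ℂ) - s))) +
    ∫ y in Ioi (1 : ℝ), egf a (-(y : ℂ)) * (y : ℂ) ^ (-s - 1)

/-! ### Entire functions with bounded Taylor coefficients, and analyticity of their differintegrals.
-/

theorem summable_egf_norm {a : ℕ → ℂ} {M : ℝ} (hM : ∀ n, ‖a n‖ ≤ M) (w : ℂ) :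
    Summable fun n : ℕ => ‖a n * w ^ n / (n.factorial : ℂ)‖ := by
  refine Summable.of_nonneg_of_le (fun _ => norm_nonneg _) (fun n => ?_)
    ((Real.summable_pow_div_factorial ‖w‖).mul_left M)
  rw [norm_div, norm_mul, norm_pow, Complex.norm_natCast, mul_div_assoc]
  exact mul_le_mul_of_nonneg_right (hM n) (by positivity)

theorem egf_zero (a : ℕ → ℂ) : egf a 0 = a 0 := by
  rw [egf, tsum_eq_single 0]
  · simp
  · intro n hn
    simp [hn]

theorem hasDerivAt_egf {a : ℕ → ℂ} {M : ℝ} (hM : ∀ n, ‖a n‖ ≤ M) (w : ℂ) :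
    HasDerivAt (egf a) (egf (fun n => a (n + 1)) w) w := by
  set R : ℝ := ‖w‖ + 1
  have hM0 : 0 ≤ M := (norm_nonneg _).trans (hM 0)
  have hR : 0 ≤ R := by positivity
  have hu : Summable fun n : ℕ => M * (n * R ^ (n - 1) / n.factorial) := by
    refine Summable.mul_left M ?_
    rw [← summable_nat_add_iff 1]
    refine (Real.summable_pow_div_factorial R).congr fun n => ?_
    rw [Nat.factorial_succ]
    push_cast
    have : (n.factorial : ℝ) ≠ 0 := by positivity
    field_simp
  have key := hasDerivAt_tsum_of_isPreconnected (𝕜 := ℂ)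
    (g := fun n w => a n * w ^ n / (n.factorial : ℂ))
    (g' := fun n w => a n * (n * w ^ (n - 1)) / (n.factorial : ℂ)) (y₀ := w) (y := w) hu
    (Metric.isOpen_ball (x := (0 : ℂ)) (ε := R)) (convex_ball _ _).isPreconnected
    (fun n y _ => ((hasDerivAt_pow n y).const_mul (a n)).div_const _)
    (fun n y hy => by
      have hy' : ‖y‖ ≤ R := by simpa using (mem_ball_zero_iff.1 hy).le
      rw [norm_div, norm_mul, norm_mul, norm_pow, Complex.norm_natCast, Complex.norm_natCast,
        mul_div_assoc]
      gcongr
      exact hM n)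
    (by simp [R]) (summable_egf_norm hM w).of_norm (by simp [R])
  convert! key using 1
  have hs : Summable fun n : ℕ => a n * (n * w ^ (n - 1)) / (n.factorial : ℂ) := by
    refine Summable.of_norm_bounded hu fun n => ?_
    rw [norm_div, norm_mul, norm_mul, norm_pow, Complex.norm_natCast, Complex.norm_natCast,
        mul_div_assoc]
    gcongr
    · exact hM n
    · simp [R]
  rw [hs.tsum_eq_zero_add]
  simp only [egf, Nat.cast_zero, zero_mul, mul_zero, zero_div, zero_add, Nat.add_sub_cancel]
  refine tsum_congr fun n => ?_
  rw [Nat.factorial_succ]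
  push_cast
  have : (n.factorial : ℂ) ≠ 0 := by exact_mod_cast n.factorial_ne_zero
  have : (n + 1 : ℂ) ≠ 0 := by exact_mod_cast n.succ_ne_zero
  field_simp

theorem differentiable_egf {a : ℕ → ℂ} {M : ℝ} (hM : ∀ n, ‖a n‖ ≤ M) :
    Differentiable ℂ (egf a) := fun w => (hasDerivAt_egf hM w).differentiableAt

theorem iteratedDeriv_egf {a : ℕ → ℂ} {M : ℝ} (hM : ∀ n, ‖a n‖ ≤ M) (m : ℕ) :
    iteratedDeriv m (egf a) = egf (fun n => a (n + m)) := by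
  induction m with
  | zero => simp
  | succ m ih =>
    rw [iteratedDeriv_succ, ih]
    funext w
    rw [(hasDerivAt_egf (fun n => hM (n + m)) w).deriv]
    congr 1
    funext n
    congr 1
    ring

theorem iteratedDeriv_egf_zero {a : ℕ → ℂ} {M : ℝ} (hM : ∀ n, ‖a n‖ ≤ M) (m : ℕ) :
    iteratedDeriv m (egf a) 0 = a m := by
  rw [iteratedDeriv_egf hM, egf_zero, zero_add]

theorem differintegral_egf {a : ℕ → ℂ} {M : ℝ} (hM : ∀ n, ‖a n‖ ≤ M) {s : ℂ}
    (hs : ∀ m : ℕ, s ≠ m) :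
    differintegral (egf a) s = (Complex.Gamma (-s))⁻¹ * mellinCont a s := by
  rw [differintegral, if_neg (hs _), mellinCont]
  simp only [iteratedDeriv_egf_zero hM]

theorem differintegral_egf_natCast {a : ℕ → ℂ} {M : ℝ} (hM : ∀ n, ‖a n‖ ≤ M) (m : ℕ) :
    differintegral (egf a) m = a m := by
  rw [differintegral, if_pos (by simp)]
  simp [iteratedDeriv_egf_zero hM]

theorem continuous_egf_neg {a : ℕ → ℂ} {M : ℝ} (hM : ∀ n, ‖a n‖ ≤ M) :
    Continuous fun y : ℝ => egf a (-(y : ℂ)) :=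
  (differentiable_egf hM).continuous.comp (by fun_prop)

theorem isClosed_range_natCast_complex : IsClosed (range ((↑) : ℕ → ℂ)) :=
  (Complex.isometry_ofReal.isClosedEmbedding.comp Nat.isClosedEmbedding_coe_real).isClosed_range

/-- The poles lie in the closed set ℕ: if a ball of radius ε about s misses ℕ, the denominators are
at least n! ε/2 on the half ball, and the M-test applies. -/
theorem differentiableAt_tsum_div_sub {a : ℕ → ℂ} {M : ℝ} (hM : ∀ n, ‖a n‖ ≤ M) {s : ℂ}
    (hs : ∀ m : ℕ, s ≠ m) :
    DifferentiableAt ℂ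
      (fun s => ∑' n : ℕ, a n * (-1) ^ n / ((n.factorial : ℂ) * ((n : ℂ) - s))) s := by
  have hmem : s ∈ (range ((↑) : ℕ → ℂ))ᶜ := by
    rintro ⟨m, hm⟩
    exact hs m hm.symm
  obtain ⟨ε, hε, hball⟩ := Metric.isOpen_iff.1 isClosed_range_natCast_complex.isOpen_compl s hmem
  have hdist : ∀ n : ℕ, ∀ t ∈ Metric.ball s (ε / 2), ε / 2 ≤ ‖(n : ℂ) - t‖ := by
    intro n t ht
    by_contra! h
    refine hball (a := (n : ℂ)) ?_ ⟨n, rfl⟩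
    rw [Metric.mem_ball] at ht ⊢
    rw [← dist_eq_norm] at h
    linarith [dist_triangle (n : ℂ) t s]
  have hM0 : 0 ≤ M := (norm_nonneg _).trans (hM 0)
  have hu : Summable fun n : ℕ => M / (n.factorial * (ε / 2)) := by
    have := (Real.summable_pow_div_factorial 1).mul_left (M / (ε / 2))
    refine this.congr fun n => ?_
    rw [one_pow, div_mul_div_comm, mul_one, mul_comm (ε / 2)]
  refine (Complex.differentiableOn_tsum_of_summable_norm hu (fun n t ht => ?_) Metric.isOpen_ball
    (fun n t ht => ?_)).differentiableAt (Metric.ball_mem_nhds s (half_pos hε))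
  · have h1 : (n.factorial : ℂ) * ((n : ℂ) - t) ≠ 0 := by
      refine mul_ne_zero (by exact_mod_cast n.factorial_ne_zero) (norm_pos_iff.1 ?_)
      linarith [hdist n t ht]
    exact DifferentiableAt.differentiableWithinAt (by fun_prop (disch := exact h1))
  · have := hdist n t ht
    rw [norm_div, norm_mul, norm_mul, norm_pow, norm_neg, norm_one, one_pow, mul_one,
      Complex.norm_natCast]
    have := hM n
    gcongr

/-- The factor `g` is there to cover the logarithm from differentiating in s and the exponential in
the Gamma integral. -/
theorem aestronglyMeasurable_mul_cpow {f : ℝ → ℂ} {u : Set ℝ} (hu : MeasurableSet u)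
    (hpos : ∀ y ∈ u, 0 < y) (hf : Continuous f) (g : ℝ → ℂ) (hg : ContinuousOn g u) (s : ℂ) :
    AEStronglyMeasurable (fun y : ℝ => f y * ((y : ℂ) ^ s * g y)) (volume.restrict u) := by
  refine ContinuousOn.aestronglyMeasurable ?_ hu
  refine hf.continuousOn.mul (ContinuousOn.mul (fun y hy => ?_) hg)
  exact (Complex.continuousAt_ofReal_cpow_const y s
    (Or.inr (hpos y hy).ne')).continuousWithinAt

theorem norm_cpow_neg_sub_one_le_one {y : ℝ} (hy : 1 ≤ y) {s : ℂ} (hs : -1 ≤ s.re) :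
    ‖(y : ℂ) ^ (-s - 1)‖ ≤ 1 := by
  rw [Complex.norm_cpow_eq_rpow_re_of_pos (by linarith)]
  refine Real.rpow_le_one_of_one_le_of_nonpos hy ?_
  simp
  linarith

theorem integrableOn_mul_cpow {f : ℝ → ℂ} (hf : Continuous f)
    (hfi : IntegrableOn f (Ioi 1)) {s : ℂ} (hs : -1 ≤ s.re) :
    IntegrableOn (fun y : ℝ => f y * (y : ℂ) ^ (-s - 1)) (Ioi 1) := by
  refine Integrable.mono hfi ?_ ?_
  · simpa using aestronglyMeasurable_mul_cpow measurableSet_Ioi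
      (fun y hy => zero_lt_one.trans hy) hf (fun _ => 1) continuousOn_const (-s - 1)
  · filter_upwards [ae_restrict_mem measurableSet_Ioi] with y hy
    rw [norm_mul]
    exact mul_le_of_le_one_right (norm_nonneg _) (norm_cpow_neg_sub_one_le_one (le_of_lt hy) hs)

theorem differentiableAt_integral_mul_cpow {f : ℝ → ℂ} (hf : Continuous f)
    (hfi : IntegrableOn f (Ioi 1)) {s : ℂ} (hs : -1 < s.re) :
    DifferentiableAt ℂ (fun s : ℂ => ∫ y in Ioi (1 : ℝ), f y * (y : ℂ) ^ (-s - 1)) s := by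
  -- Half the distance from s to the line Re = -1: on the ε-ball the power is at most y^(-ε), which
  -- absorbs log y ≤ y^ε/ε.
  set ε : ℝ := (s.re + 1) / 2 with hε_def
  have hε : 0 < ε := by rw [hε_def]; linarith
  have hre : ∀ t ∈ Metric.ball s ε, ε - 1 ≤ t.re := by
    intro t ht
    have h1 := (Complex.abs_re_le_norm (t - s)).trans_lt (mem_ball_iff_norm.1 ht)
    rw [Complex.sub_re, abs_lt] at h1
    linarith
  refine (hasDerivAt_integral_of_dominated_loc_of_deriv_le
    (μ := volume.restrict (Ioi (1 : ℝ)))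
    (F' := fun t y => f y * ((y : ℂ) ^ (-t - 1) * (Complex.log y * (-1))))
    (bound := fun y => ‖f y‖ * (1 / ε)) (Metric.ball_mem_nhds s hε) ?_ ?_ ?_ ?_ ?_ ?_).2.differentiableAt
  · refine Eventually.of_forall fun t => ?_
    simpa using aestronglyMeasurable_mul_cpow measurableSet_Ioi
      (fun y hy => zero_lt_one.trans hy) hf (fun _ => 1) continuousOn_const (-t - 1)
  · exact integrableOn_mul_cpow hf hfi hs.le
  · refine aestronglyMeasurable_mul_cpow measurableSet_Ioi
      (fun y hy => zero_lt_one.trans hy) hf _ ?_ (-s - 1)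
    intro y hy
    have : (y : ℂ) ∈ Complex.slitPlane := Or.inl (by simpa using zero_lt_one.trans hy)
    refine ContinuousAt.continuousWithinAt (ContinuousAt.mul ?_ continuousAt_const)
    exact ContinuousAt.clog (by fun_prop) this
  · filter_upwards [ae_restrict_mem measurableSet_Ioi] with y hy t ht
    have hy1 : (1 : ℝ) < y := hy
    have hy0 : (0 : ℝ) < y := by linarith
    rw [norm_mul]
    refine mul_le_mul_of_nonneg_left ?_ (norm_nonneg _)
    rw [norm_mul, norm_mul, norm_neg, norm_one, mul_one, ← Complex.ofReal_log hy0.le,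
      Complex.norm_real, Real.norm_of_nonneg (Real.log_nonneg hy1.le),
      Complex.norm_cpow_eq_rpow_re_of_pos hy0]
    calc y ^ (-t - 1).re * Real.log y ≤ y ^ (-ε) * (y ^ ε / ε) := by
          refine mul_le_mul ?_ (Real.log_le_rpow_div hy0.le hε) (Real.log_nonneg hy1.le)
            (by positivity)
          refine Real.rpow_le_rpow_of_exponent_le hy1.le ?_
          have := hre t ht
          simp
          linarith
      _ = 1 / ε := by
          rw [Real.rpow_neg hy0.le]
          field_simp
  · exact hfi.norm.mul_const _
  · filter_upwards [ae_restrict_mem measurableSet_Ioi] with y hy t _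
    have hy0 : (y : ℂ) ≠ 0 := by
      exact_mod_cast (zero_lt_one.trans (show (1 : ℝ) < y from hy)).ne'
    have h := (((hasDerivAt_id t).neg.sub_const 1).const_cpow (c := (y : ℂ)) (Or.inl hy0))
    have h2 := h.const_mul (f y)
    convert! h2 using 1
    simp only [id, Pi.neg_apply]
    ring

theorem differentiableAt_mellinCont {a : ℕ → ℂ} {M : ℝ} (hM : ∀ n, ‖a n‖ ≤ M)
    (hint : IntegrableOn (fun y : ℝ => egf a (-(y : ℂ))) (Ioi 1)) {s : ℂ}
    (hs : ∀ m : ℕ, s ≠ m) (hre : -1 < s.re) :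
    DifferentiableAt ℂ (mellinCont a) s :=
  (differentiableAt_tsum_div_sub hM hs).add
    (differentiableAt_integral_mul_cpow (continuous_egf_neg hM) hint hre)

theorem differentiableAt_differintegral_egf {a : ℕ → ℂ} {M : ℝ} (hM : ∀ n, ‖a n‖ ≤ M)
    (hint : IntegrableOn (fun y : ℝ => egf a (-(y : ℂ))) (Ioi 1)) {s : ℂ}
    (hs : ∀ m : ℕ, s ≠ m) (hre : -1 < s.re) :
    DifferentiableAt ℂ (differintegral (egf a)) s := by
  have h1 : DifferentiableAt ℂ (fun s => (Complex.Gamma (-s))⁻¹ * mellinCont a s) s :=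
    (Complex.differentiable_one_div_Gamma.comp differentiable_neg).differentiableAt.mul
      (differentiableAt_mellinCont hM hint hs hre)
  refine h1.congr_of_eventuallyEq ?_
  have : ∀ᶠ t in 𝓝 s, t ∈ (range ((↑) : ℕ → ℂ))ᶜ :=
    isClosed_range_natCast_complex.isOpen_compl.mem_nhds fun ⟨m, hm⟩ => hs m hm.symm
  filter_upwards [this] with t ht
  exact differintegral_egf hM fun m hm => ht ⟨m, hm.symm⟩

/-- On (0, 1] the Taylor series is integrated term by term, each power giving 1/(n - s); the norms
sum because of the factorials. -/
theorem mellinCont_eq_integral {a : ℕ → ℂ} {M : ℝ} (hM : ∀ n, ‖a n‖ ≤ M)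
    (hint : IntegrableOn (fun y : ℝ => egf a (-(y : ℂ))) (Ioi 1)) {s : ℂ}
    (h1 : -1 < s.re) (h0 : s.re < 0) :
    mellinCont a s = ∫ y in Ioi (0 : ℝ), egf a (-(y : ℂ)) * (y : ℂ) ^ (-s - 1) := by
  have hM0 : 0 ≤ M := (norm_nonneg _).trans (hM 0)
  set F : ℕ → ℝ → ℂ := fun n y => (a n * (-1) ^ n / n.factorial) * (y : ℂ) ^ ((n : ℂ) - s - 1)
  have hn0 : ∀ n : ℕ, (0 : ℝ) ≤ n := fun n => n.cast_nonneg
  have hFi : ∀ n, IntegrableOn (F n) (Ioc 0 1) := by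
    intro n
    have := intervalIntegral.intervalIntegrable_cpow' (a := 0) (b := 1)
      (r := (n : ℂ) - s - 1) (by simp; linarith [hn0 n])
    rw [intervalIntegrable_iff_integrableOn_Ioc_of_le zero_le_one] at this
    exact this.const_mul _
  have hFv : ∀ n, ∫ y in Ioc (0 : ℝ) 1, F n y
      = a n * (-1) ^ n / ((n.factorial : ℂ) * ((n : ℂ) - s)) := by
    intro n
    have hne : (n : ℂ) - s ≠ 0 := by
      intro h
      have := congrArg Complex.re h
      simp at this
      linarith [hn0 n]
    simp only [F]
    rw [integral_const_mul, ← intervalIntegral.integral_of_le zero_le_one,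
      integral_cpow (Or.inl (by simp; linarith [hn0 n]))]
    rw [sub_add_cancel]
    simp [hne, div_eq_mul_inv, mul_comm, mul_assoc, mul_left_comm]
  have hFn : ∀ n, ∫ y in Ioc (0 : ℝ) 1, ‖F n y‖ = ‖a n‖ / n.factorial * (1 / (n - s.re)) := by
    intro n
    have : ∀ y ∈ Ioc (0 : ℝ) 1, ‖F n y‖ = ‖a n‖ / n.factorial * y ^ ((n : ℝ) - s.re - 1) := by
      intro y hy
      simp only [F]
      rw [norm_mul, Complex.norm_cpow_eq_rpow_re_of_pos hy.1]
      simp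
    rw [setIntegral_congr_fun measurableSet_Ioc this, integral_const_mul,
      ← intervalIntegral.integral_of_le zero_le_one,
      integral_rpow (Or.inl (by linarith [hn0 n])), sub_add_cancel, Real.one_rpow,
      Real.zero_rpow (by linarith [hn0 n]), sub_zero]
  have hsum : Summable fun n => ∫ y in Ioc (0 : ℝ) 1, ‖F n y‖ := by
    refine Summable.of_nonneg_of_le (fun n => by positivity) (fun n => ?_)
      ((Real.summable_pow_div_factorial 1).mul_left (M * (1 / (-s.re))))
    rw [hFn, one_pow, mul_assoc M, mul_one_div (1 / -s.re), div_eq_mul_one_div ‖a n‖, mul_assoc,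
      mul_comm (1 / (n.factorial : ℝ)), ← mul_one_div (1 / -s.re)]
    have := hM n
    have := hn0 n
    gcongr
    · have : 0 < (n : ℝ) - s.re := by linarith
      positivity
    · linarith
    · linarith
  have hpt : ∀ y ∈ Ioc (0 : ℝ) 1, egf a (-(y : ℂ)) * (y : ℂ) ^ (-s - 1) = ∑' n, F n y := by
    intro y hy
    have hy0 : (y : ℂ) ≠ 0 := by exact_mod_cast hy.1.ne'
    rw [egf, ← tsum_mul_right]
    refine tsum_congr fun n => ?_
    simp only [F]
    rw [show (n : ℂ) - s - 1 = n + (-s - 1) by ring, Complex.cpow_add _ _ hy0,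
      Complex.cpow_natCast, neg_pow]
    ring
  have hIoc : HasSum (fun n : ℕ => a n * (-1) ^ n / ((n.factorial : ℂ) * ((n : ℂ) - s)))
      (∫ y in Ioc (0 : ℝ) 1, egf a (-(y : ℂ)) * (y : ℂ) ^ (-s - 1)) := by
    have := hasSum_integral_of_summable_integral_norm (μ := volume.restrict (Ioc (0 : ℝ) 1)) hFi hsum
    rw [setIntegral_congr_fun measurableSet_Ioc hpt]
    simpa only [hFv] using this
  have hIoci : IntegrableOn (fun y : ℝ => egf a (-(y : ℂ)) * (y : ℂ) ^ (-s - 1)) (Ioc 0 1) := by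
    have hc := intervalIntegral.intervalIntegrable_cpow' (a := 0) (b := 1)
      (r := -s - 1) (by simp; linarith)
    exact ((hc.continuousOn_mul (continuous_egf_neg hM).continuousOn).1)
  rw [mellinCont, hIoc.tsum_eq, ← Ioc_union_Ioi_eq_Ioi (zero_le_one (α := ℝ)),
    setIntegral_union (Ioc_disjoint_Ioi le_rfl) measurableSet_Ioi hIoci
      (integrableOn_mul_cpow (continuous_egf_neg hM) hint h1.le)]

/-! ### Integration by parts: shifting the coefficients against shifting the order. -/

theorem hasDerivAt_egf_neg {a : ℕ → ℂ} {M : ℝ} (hM : ∀ n, ‖a n‖ ≤ M) (y : ℝ) :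
    HasDerivAt (fun y : ℝ => egf a (-(y : ℂ))) (-egf (fun n => a (n + 1)) (-(y : ℂ))) y := by
  have h := ((hasDerivAt_egf hM (-(y : ℂ))).comp (y : ℂ) (hasDerivAt_neg (y : ℂ))).comp_ofReal
  simpa using h

/-- Termwise, (-s-1)/(n-(s+1)) = 1 - n/(n-(s+1)); the second part vanishes at n = 0 and is
reindexed. The value `egf a (-1)` cancels the boundary term at y = 1 in `mellinCont_shift`. -/
theorem tsum_div_sub_shift {a : ℕ → ℂ} {M : ℝ} (hM : ∀ n, ‖a n‖ ≤ M) {s : ℂ}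
    (hs : ∀ m : ℕ, s + 1 ≠ m) :
    (∑' n : ℕ, a (n + 1) * (-1) ^ n / ((n.factorial : ℂ) * ((n : ℂ) - s))) + egf a (-1) =
      (-s - 1) * ∑' n : ℕ, a n * (-1) ^ n / ((n.factorial : ℂ) * ((n : ℂ) - (s + 1))) := by
  have hne : ∀ n : ℕ, (n : ℂ) - (s + 1) ≠ 0 := fun n => sub_ne_zero.2 (hs n).symm
  have hf : ∀ n : ℕ, (n.factorial : ℂ) ≠ 0 := fun n => by exact_mod_cast n.factorial_ne_zero
  have hegf : Summable fun n : ℕ => a n * (-1) ^ n / (n.factorial : ℂ) :=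
    (summable_egf_norm hM (-1)).of_norm
  have hterm : ∀ n : ℕ, (-s - 1) * (a n * (-1) ^ n / ((n.factorial : ℂ) * ((n : ℂ) - (s + 1))))
      = a n * (-1) ^ n / (n.factorial : ℂ)
        - n * (a n * (-1) ^ n / ((n.factorial : ℂ) * ((n : ℂ) - (s + 1)))) := by
    intro n
    have := hne n
    have := hf n
    field_simp
    ring
  set g : ℕ → ℂ := fun n => n * (a n * (-1) ^ n / ((n.factorial : ℂ) * ((n : ℂ) - (s + 1))))
  have hgs : ∀ n : ℕ, g (n + 1) = -(a (n + 1) * (-1) ^ n / ((n.factorial : ℂ) * ((n : ℂ) - s))) := by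
    intro n
    simp only [g]
    have h1 := hne (n + 1)
    have h2 : (n : ℂ) - s ≠ 0 := by
      intro h
      apply h1
      push_cast
      linear_combination h
    have := hf n
    have h3 : (n + 1 : ℂ) ≠ 0 := by exact_mod_cast n.succ_ne_zero
    rw [Nat.factorial_succ]
    push_cast
    rw [show (n : ℂ) + 1 - (s + 1) = n - s by ring]
    field_simp
    ring
  have hbdd : Summable fun n : ℕ => a n * (-1) ^ n / ((n.factorial : ℂ) * ((n : ℂ) - (s + 1))) := by
    have hev : ∀ᶠ n : ℕ in atTop, 1 ≤ ‖(n : ℂ) - (s + 1)‖ := by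
      filter_upwards [eventually_ge_atTop (⌈‖s + 1‖ + 1⌉₊)] with n hn
      have h1 : ‖s + 1‖ + 1 ≤ n := (Nat.le_ceil _).trans (by exact_mod_cast hn)
      have h2 := norm_sub_norm_le (n : ℂ) (s + 1)
      rw [Complex.norm_natCast] at h2
      linarith
    refine Summable.of_norm_bounded_eventually_nat hegf.norm ?_
    filter_upwards [hev] with n hn
    rw [← div_div, norm_div]
    exact div_le_self (norm_nonneg _) hn
  have hg : Summable g :=
    (hegf.sub (hbdd.mul_left (-s - 1))).congr fun n => by rw [hterm]; ring
  rw [← tsum_mul_left, tsum_congr hterm, hegf.tsum_sub hg, hg.tsum_eq_zero_add]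
  simp only [hgs, tsum_neg]
  simp only [g, Nat.cast_zero, zero_mul, zero_add, egf]
  ring

theorem mellinCont_shift {a : ℕ → ℂ} {M : ℝ} (hM : ∀ n, ‖a n‖ ≤ M) {s : ℂ}
    (hs : ∀ m : ℕ, s + 1 ≠ m)
    (h1 : IntegrableOn (fun y : ℝ => egf (fun n => a (n + 1)) (-(y : ℂ)) * (y : ℂ) ^ (-s - 1)) (Ioi 1))
    (h2 : IntegrableOn (fun y : ℝ => egf a (-(y : ℂ)) * (y : ℂ) ^ (-(s + 1) - 1)) (Ioi 1))
    (h3 : Tendsto (fun y : ℝ => egf a (-(y : ℂ)) * (y : ℂ) ^ (-s - 1)) atTop (𝓝 0)) :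
    mellinCont (fun n => a (n + 1)) s = (-s - 1) * mellinCont a (s + 1) := by
  have hs1 : -s - 1 ≠ 0 := by
    intro h
    apply hs 0
    push_cast
    linear_combination -h
  have hderiv : ∀ y ∈ Ici (1 : ℝ), HasDerivAt (fun y : ℝ => egf a (-(y : ℂ)) * (y : ℂ) ^ (-s - 1))
      (-(egf (fun n => a (n + 1)) (-(y : ℂ)) * (y : ℂ) ^ (-s - 1))
        + (-s - 1) * (egf a (-(y : ℂ)) * (y : ℂ) ^ (-(s + 1) - 1))) y := by
    intro y hy
    have hy0 : y ≠ 0 := (zero_lt_one.trans_le (show (1 : ℝ) ≤ y from hy)).ne'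
    -- The power rule used here differentiates y^(r+1)/(r+1), hence r = -s-2 and the compensating
    -- factor -s-1.
    have h := (hasDerivAt_egf_neg hM y).mul
      (hasDerivAt_ofReal_cpow_const' (r := -s - 2) hy0 (by
        intro h
        apply hs1
        linear_combination h)|>.const_mul (-s - 1))
    rw [show -s - 2 + 1 = -s - 1 by ring] at h
    convert! h using 1
    · funext y
      simp only [Pi.mul_apply]
      field_simp
    · rw [show -(s + 1) - 1 = -s - 2 by ring]
      field_simp
  have key := integral_Ioi_of_hasDerivAt_of_tendsto' hderiv
    (h1.neg.add (h2.const_mul _)) h3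
  rw [integral_add (by exact h1.neg) (h2.const_mul _), integral_neg, integral_const_mul] at key
  have hsum := tsum_div_sub_shift hM hs
  rw [mellinCont, mellinCont, mul_add, ← hsum]
  simp only [Complex.ofReal_one, Complex.one_cpow, mul_one] at key
  linear_combination -key

/-- By the mean value inequality, undoing one derivative costs one power of y. -/
theorem norm_egf_neg_le_of_shift {a : ℕ → ℂ} {M : ℝ} (hM : ∀ n, ‖a n‖ ≤ M) {k : ℕ} {K : ℝ}
    (hK : ∀ y : ℝ, 1 ≤ y → ‖egf (fun n => a (n + 1)) (-(y : ℂ))‖ ≤ K * y ^ k) {y : ℝ} (hy : 1 ≤ y) :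
    ‖egf a (-(y : ℂ))‖ ≤ (‖egf a (-1)‖ + K) * y ^ (k + 1) := by
  have hK0 : 0 ≤ K := by simpa using (norm_nonneg _).trans (hK 1 le_rfl)
  have h := (convex_Icc 1 y).norm_image_sub_le_of_norm_hasDerivWithin_le
    (f := fun y : ℝ => egf a (-(y : ℂ))) (C := K * y ^ k)
    (fun t _ => (hasDerivAt_egf_neg hM t).hasDerivWithinAt)
    (fun t ht => by
      rw [norm_neg]
      refine (hK t ht.1).trans ?_
      have := ht.1
      have := ht.2
      gcongr) (left_mem_Icc.2 hy) (right_mem_Icc.2 hy)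
  simp only [Complex.ofReal_one] at h
  rw [Real.norm_of_nonneg (by linarith)] at h
  have h2 := norm_sub_norm_le (egf a (-(y : ℂ))) (egf a (-1))
  have h3 : 1 ≤ y ^ (k + 1) := one_le_pow₀ hy
  have h4 : K * y ^ k * (y - 1) ≤ K * y ^ (k + 1) := by
    rw [pow_succ, ← mul_assoc]
    gcongr
    linarith
  nlinarith [norm_nonneg (egf a (-1))]

theorem norm_egf_neg_le_of_integrable {a : ℕ → ℂ} {M : ℝ} (hM : ∀ n, ‖a n‖ ≤ M)
    (hint : IntegrableOn (fun y : ℝ => egf (fun n => a (n + 1)) (-(y : ℂ))) (Ioi 1)) :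
    ∃ K, ∀ y : ℝ, 1 ≤ y → ‖egf a (-(y : ℂ))‖ ≤ K := by
  refine ⟨‖egf a (-1)‖ + ∫ t in Ioi (1 : ℝ), ‖egf (fun n => a (n + 1)) (-(t : ℂ))‖, fun y hy => ?_⟩
  have hc := (continuous_egf_neg fun n => hM (n + 1)).neg
  have h := intervalIntegral.integral_eq_sub_of_hasDerivAt (a := 1) (b := y)
    (fun t _ => hasDerivAt_egf_neg hM t) (hc.intervalIntegrable _ _)
  have h2 : ‖∫ t in (1 : ℝ)..y, -egf (fun n => a (n + 1)) (-(t : ℂ))‖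
      ≤ ∫ t in Ioi (1 : ℝ), ‖egf (fun n => a (n + 1)) (-(t : ℂ))‖ := by
    refine (intervalIntegral.norm_integral_le_integral_norm hy).trans ?_
    simp only [norm_neg]
    rw [intervalIntegral.integral_of_le hy]
    exact setIntegral_mono_set hint.norm (Eventually.of_forall fun _ => norm_nonneg _)
      Ioc_subset_Ioi_self.eventuallyLE
  rw [h] at h2
  simp only [Complex.ofReal_one] at h2
  linarith [norm_sub_norm_le (egf a (-(y : ℂ))) (egf a (-1))]

theorem integrableOn_egf_mul_cpow {a : ℕ → ℂ} {M : ℝ} (hM : ∀ n, ‖a n‖ ≤ M) {k : ℕ} {K : ℝ}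
    (hK : ∀ y : ℝ, 1 ≤ y → ‖egf a (-(y : ℂ))‖ ≤ K * y ^ k) {s : ℂ} (hs : k < s.re) :
    IntegrableOn (fun y : ℝ => egf a (-(y : ℂ)) * (y : ℂ) ^ (-s - 1)) (Ioi 1) := by
  have hr : IntegrableOn (fun y : ℝ => K * y ^ ((k : ℝ) - s.re - 1)) (Ioi 1) :=
    (integrableOn_Ioi_rpow_of_lt (by linarith) zero_lt_one).const_mul K
  refine Integrable.mono' hr ?_ ?_
  · simpa using aestronglyMeasurable_mul_cpow measurableSet_Ioi
      (fun y hy => zero_lt_one.trans hy) (continuous_egf_neg hM) (fun _ => 1) continuousOn_const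
      (-s - 1)
  · filter_upwards [ae_restrict_mem measurableSet_Ioi] with y hy
    have hy1 : (1 : ℝ) < y := hy
    have hy0 : 0 < y := by linarith
    rw [norm_mul, Complex.norm_cpow_eq_rpow_re_of_pos hy0,
      show (k : ℝ) - s.re - 1 = k + (-s - 1).re by simp; ring, Real.rpow_add hy0,
      Real.rpow_natCast, ← mul_assoc]
    exact mul_le_mul_of_nonneg_right (hK y hy1.le) (by positivity)

theorem tendsto_egf_mul_cpow {a : ℕ → ℂ} {k : ℕ} {K : ℝ}
    (hK : ∀ y : ℝ, 1 ≤ y → ‖egf a (-(y : ℂ))‖ ≤ K * y ^ k) {s : ℂ} (hs : (k : ℝ) - 1 < s.re) :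
    Tendsto (fun y : ℝ => egf a (-(y : ℂ)) * (y : ℂ) ^ (-s - 1)) atTop (𝓝 0) := by
  have hr : Tendsto (fun y : ℝ => K * y ^ (-(s.re + 1 - k))) atTop (𝓝 (K * 0)) :=
    (tendsto_rpow_neg_atTop (by linarith)).const_mul K
  rw [mul_zero] at hr
  refine squeeze_zero_norm' ?_ hr
  filter_upwards [eventually_ge_atTop 1] with y hy
  have hy0 : 0 < y := by linarith
  rw [norm_mul, Complex.norm_cpow_eq_rpow_re_of_pos hy0,
    show -(s.re + 1 - k) = k + (-s - 1).re by simp; ring, Real.rpow_add hy0,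
    Real.rpow_natCast, ← mul_assoc]
  exact mul_le_mul_of_nonneg_right (hK y hy) (by positivity)

/-- The factor -s-1 from `mellinCont_shift` is absorbed by Γ(-s) = -(s+1) Γ(-(s+1)). At integer
orders both sides are coefficients by definition. -/
theorem differintegral_egf_succ {a : ℕ → ℂ} {M : ℝ} (hM : ∀ n, ‖a n‖ ≤ M) {k : ℕ} {K : ℝ}
    (hK : ∀ y : ℝ, 1 ≤ y → ‖egf a (-(y : ℂ))‖ ≤ K * y ^ k) {s : ℂ} (hs : (k : ℝ) - 1 < s.re)
    (hint : IntegrableOn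
      (fun y : ℝ => egf (fun n => a (n + 1)) (-(y : ℂ)) * (y : ℂ) ^ (-s - 1)) (Ioi 1)) :
    differintegral (egf a) (s + 1) = differintegral (egf fun n => a (n + 1)) s := by
  by_cases hm : ∃ m : ℕ, s + 1 = m
  · obtain ⟨m, hm⟩ := hm
    have hm0 : m ≠ 0 := by
      rintro rfl
      have := congrArg Complex.re hm
      simp at this
      have : (0 : ℝ) ≤ k := k.cast_nonneg
      linarith
    obtain ⟨m, rfl⟩ := Nat.exists_eq_succ_of_ne_zero hm0
    have hs' : s = m := by
      push_cast at hm
      linear_combination hm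
    rw [hm, differintegral_egf_natCast hM, hs', differintegral_egf_natCast fun n => hM (n + 1)]
  · push Not at hm
    have hs' : ∀ m : ℕ, s ≠ m := by
      intro m h
      apply hm (m + 1)
      rw [h]
      push_cast
      ring
    have hs1 : -(s + 1) ≠ 0 := neg_ne_zero.2 (by simpa using hm 0)
    have hs2 : s + 1 ≠ 0 := neg_ne_zero.1 hs1
    have hsh := mellinCont_shift hM hm hint
      (integrableOn_egf_mul_cpow hM hK (by simp; linarith)) (tendsto_egf_mul_cpow hK hs)
    rw [differintegral_egf hM hm, differintegral_egf (fun n => hM (n + 1)) hs', hsh,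
      show -s = -(s + 1) + 1 by ring, Complex.Gamma_add_one _ hs1,
      show -(s + 1) + 1 - 1 = -(s + 1) by ring, mul_inv]
    field_simp

/-- Differentiation before the differintegral raises its order. -/
theorem differintegral_egf_add_natCast {a : ℕ → ℂ} {M : ℝ} (hM : ∀ n, ‖a n‖ ≤ M) (N : ℕ)
    (hint : IntegrableOn (fun y : ℝ => egf (fun n => a (n + N)) (-(y : ℂ))) (Ioi 1)) {s : ℂ}
    (hs : -1 < s.re) :
    differintegral (egf a) (s + N) = differintegral (egf fun n => a (n + N)) s := by
  -- Only the N-th derivative is known to be integrable, so the induction also carries growth of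
  -- order y^(N-1), which kills the boundary term at infinity. It ranges over all `a` because its
  -- hypothesis is applied to the shifted sequence.
  have hgrow : ∀ j : ℕ, ∀ N : ℕ, ∀ a : ℕ → ℂ, (∀ n, ‖a n‖ ≤ M) → N = j + 1 →
      IntegrableOn (fun y : ℝ => egf (fun n => a (n + N)) (-(y : ℂ))) (Ioi 1) →
      (∃ K, ∀ y : ℝ, 1 ≤ y → ‖egf a (-(y : ℂ))‖ ≤ K * y ^ j) ∧
      differintegral (egf a) (s + N) = differintegral (egf fun n => a (n + N)) s := by
    intro j
    induction j with
    | zero =>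
      rintro N a ha rfl hN
      simp only [zero_add] at hN ⊢
      obtain ⟨K, hK⟩ := norm_egf_neg_le_of_integrable ha hN
      have hK' : ∀ y : ℝ, 1 ≤ y → ‖egf a (-(y : ℂ))‖ ≤ K * y ^ 0 := by simpa using hK
      refine ⟨⟨K, hK'⟩, ?_⟩
      rw [Nat.cast_one]
      exact differintegral_egf_succ ha hK' (by simpa using hs)
        (integrableOn_mul_cpow (continuous_egf_neg fun n => ha (n + 1)) hN hs.le)
    | succ j ih =>
      rintro N a ha rfl hN
      obtain ⟨⟨K, hK⟩, heq⟩ := ih (j + 1) (fun n => a (n + 1)) (fun n => ha (n + 1)) rfl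
        (by simpa only [add_assoc] using hN)
      have hK' := fun y hy => norm_egf_neg_le_of_shift ha hK (y := y) hy
      refine ⟨⟨_, hK'⟩, ?_⟩
      have h := differintegral_egf_succ (s := s + ((j + 1 : ℕ) : ℂ)) ha hK'
        (by simp; linarith)
        (integrableOn_egf_mul_cpow (fun n => ha (n + 1)) hK (by simp; linarith))
      rw [heq] at h
      simp only [add_assoc] at h ⊢
      rw [← h]
      congr 2
      push_cast
      ring
  rcases N with _ | j
  · simp
  · exact (hgrow j (j + 1) a hM rfl hint).2

theorem MeasureTheory.integrable_tsum_of_summable_integral_norm {α ι E : Type*}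
    [MeasurableSpace α] {μ : Measure α} [Countable ι] [NormedAddCommGroup E] {F : ι → α → E}
    (hF : ∀ i, Integrable (F i) μ) (hs : Summable fun i => ∫ x, ‖F i x‖ ∂μ)
    (hm : AEStronglyMeasurable (fun x => ∑' i, F i x) μ) :
    Integrable (fun x => ∑' i, F i x) μ := by
  refine ⟨hm, ?_⟩
  calc ∫⁻ x, ‖∑' i, F i x‖ₑ ∂μ ≤ ∫⁻ x, ∑' i, ‖F i x‖ₑ ∂μ :=
        lintegral_mono fun x => enorm_tsum_le_tsum_enorm
    _ = ∑' i, ∫⁻ x, ‖F i x‖ₑ ∂μ := lintegral_tsum fun i => (hF i).aestronglyMeasurable.enorm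
    _ = ∑' i, ENNReal.ofReal (∫ x, ‖F i x‖ ∂μ) := by
        refine tsum_congr fun i => ?_
        rw [ofReal_integral_norm_eq_lintegral_enorm (hF i)]
    _ < ⊤ := hs.tsum_ofReal_lt_top

/-- The injection w ↦ (exp(Re w) - 1) + i Im w maps ℂ onto the half-plane, and the complement of a
countable set in ℂ is path connected. -/
theorem isPreconnected_halfPlane_diff_natCast :
    IsPreconnected {s : ℂ | -1 < s.re ∧ ∀ m : ℕ, s ≠ m} := by
  set g : ℂ → ℂ := fun w => ((Real.exp w.re - 1 : ℝ) : ℂ) + (w.im : ℂ) * Complex.I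
  have hre : ∀ w, (g w).re = Real.exp w.re - 1 := fun w => by
    simp [g, -Complex.ofReal_exp, -Complex.ofReal_sub]
  have him : ∀ w, (g w).im = w.im := fun w => by simp [g]
  have hginj : Function.Injective g := by
    intro w w' h
    have h1 := congrArg Complex.re h
    have h2 := congrArg Complex.im h
    rw [hre, hre, sub_left_inj] at h1
    rw [him, him] at h2
    exact Complex.ext (Real.exp_injective h1) h2
  have hgc : Continuous g := by fun_prop
  have hcount : (g ⁻¹' range ((↑) : ℕ → ℂ)).Countable :=
    (countable_range _).preimage hginj
  have hrank : 1 < Module.rank ℝ ℂ := by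
    rw [Complex.rank_real_complex]
    exact Nat.one_lt_ofNat
  have h := (hcount.isPathConnected_compl_of_one_lt_rank hrank).isConnected.isPreconnected.image g
    hgc.continuousOn
  convert! h using 1
  ext s
  constructor
  · rintro ⟨h1, h2⟩
    refine ⟨⟨Real.log (s.re + 1), s.im⟩, ?_, ?_⟩
    swap
    · apply Complex.ext
      · rw [hre, Real.exp_log (by linarith)]
        ring
      · rw [him]
    · rintro ⟨m, hm⟩
      apply h2 m
      rw [hm]
      apply Complex.ext
      · rw [hre, Real.exp_log (by linarith)]
        ring
      · rw [him]
  · rintro ⟨w, hw, rfl⟩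
    refine ⟨by rw [hre]; linarith [Real.exp_pos w.re], fun m hm => hw ⟨m, hm.symm⟩⟩

theorem isOpen_halfPlane_diff_natCast : IsOpen {s : ℂ | -1 < s.re ∧ ∀ m : ℕ, s ≠ m} := by
  have h : {s : ℂ | -1 < s.re ∧ ∀ m : ℕ, s ≠ m} =
      {s : ℂ | -1 < s.re} ∩ (range ((↑) : ℕ → ℂ))ᶜ := by
    ext s
    simp [eq_comm]
  rw [h]
  exact (isOpen_lt continuous_const Complex.continuous_re).inter
    isClosed_range_natCast_complex.isOpen_compl

/-! ### Differintegrals of mixtures of decaying exponentials. -/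

section Mixture

variable {β : ℕ → ℂ} {r : ℕ → ℝ}

theorem norm_mul_ofReal_pow_le (hr0 : ∀ k, 0 < r k) (hr1 : ∀ k, r k ≤ 1) (k n : ℕ) :
    ‖β k * (r k : ℂ) ^ n‖ ≤ ‖β k‖ := by
  rw [norm_mul, norm_pow, Complex.norm_real, Real.norm_of_nonneg (hr0 k).le]
  exact mul_le_of_le_one_right (norm_nonneg _) (pow_le_one₀ (hr0 k).le (hr1 k))

theorem norm_tsum_mixture_le (hβ : Summable fun k => ‖β k‖) (hr0 : ∀ k, 0 < r k)
    (hr1 : ∀ k, r k ≤ 1) (n : ℕ) :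
    ‖∑' k, β k * (r k : ℂ) ^ (n + 1)‖ ≤ ∑' k, ‖β k‖ :=
  tsum_of_norm_bounded hβ.hasSum fun k => norm_mul_ofReal_pow_le hr0 hr1 k (n + 1)

/-- The double series is dominated by Σ |w|ⁿ/n! · Σ |β_k|, so the sums may be exchanged. The
exponent n+1 leaves the factor r_k outside the exponential. -/
theorem egf_mixture (hβ : Summable fun k => ‖β k‖) (hr0 : ∀ k, 0 < r k)
    (hr1 : ∀ k, r k ≤ 1) (w : ℂ) :
    egf (fun n => ∑' k, β k * (r k : ℂ) ^ (n + 1)) w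
      = ∑' k, β k * r k * Complex.exp (r k * w) := by
  have hsum : Summable fun p : ℕ × ℕ =>
      β p.2 * (r p.2 : ℂ) ^ (p.1 + 1) * (w ^ p.1 / (p.1.factorial : ℂ)) := by
    have h := (Real.summable_pow_div_factorial ‖w‖).mul_of_nonneg hβ
      (fun _ => by positivity) (fun _ => norm_nonneg _)
    refine Summable.of_norm_bounded h fun p => ?_
    rw [norm_mul, mul_comm, norm_div, norm_pow, Complex.norm_natCast]
    exact mul_le_mul_of_nonneg_left (norm_mul_ofReal_pow_le hr0 hr1 _ _) (by positivity)
  calc egf (fun n => ∑' k, β k * (r k : ℂ) ^ (n + 1)) w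
      = ∑' n : ℕ, ∑' k, β k * (r k : ℂ) ^ (n + 1) * (w ^ n / (n.factorial : ℂ)) := by
        rw [egf]
        refine tsum_congr fun n => ?_
        rw [mul_div_assoc, tsum_mul_right]
    _ = ∑' k, ∑' n : ℕ, β k * (r k : ℂ) ^ (n + 1) * (w ^ n / (n.factorial : ℂ)) :=
        (Summable.tsum_comm hsum).symm
    _ = _ := by
        refine tsum_congr fun k => ?_
        rw [Complex.exp_eq_exp_ℂ, NormedSpace.exp_eq_tsum_div, ← tsum_mul_left]
        refine tsum_congr fun n => ?_
        rw [mul_pow]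
        ring

theorem integrableOn_exp_neg_mul_Ioi {c : ℂ} (hc : 0 < c.re) :
    IntegrableOn (fun x : ℝ => Complex.exp (-(c * x))) (Ioi 0) := by
  simpa using integrableOn_exp_mul_complex_Ioi (a := -c) (by simpa using hc) 0

theorem integral_norm_exp_neg_mul_Ioi {c : ℂ} (hc : 0 < c.re) :
    ∫ x in Ioi (0 : ℝ), ‖Complex.exp (-(c * x))‖ = 1 / c.re := by
  have h : ∀ x : ℝ, ‖Complex.exp (-(c * x))‖ = Real.exp (-c.re * x) := fun x => by
    rw [Complex.norm_exp]
    simp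
  simp only [h]
  rw [integral_exp_mul_Ioi (by linarith)]
  simp [neg_div_neg_eq]

/-- The factor r_k cancels the integral 1/(r_k Re e) of the k-th exponential, so no lower bound on
the rates is needed. -/
theorem integrableOn_egf_mixture_ray (hβ : Summable fun k => ‖β k‖) (hr0 : ∀ k, 0 < r k)
    (hr1 : ∀ k, r k ≤ 1) {e : ℂ} (he : 0 < e.re) :
    IntegrableOn (fun x : ℝ =>
      egf (fun n => ∑' k, β k * (r k : ℂ) ^ (n + 1)) (-((x : ℂ) * e))) (Ioi 0) := by
  have hre : ∀ k, 0 < ((r k : ℂ) * e).re := fun k => by simpa using mul_pos (hr0 k) he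
  have hcont : Continuous fun x : ℝ =>
      egf (fun n => ∑' k, β k * (r k : ℂ) ^ (n + 1)) (-((x : ℂ) * e)) :=
    (differentiable_egf (norm_tsum_mixture_le hβ hr0 hr1)).continuous.comp (by fun_prop)
  have heq : (fun x : ℝ => egf (fun n => ∑' k, β k * (r k : ℂ) ^ (n + 1)) (-((x : ℂ) * e)))
      = fun x : ℝ => ∑' k, β k * r k * Complex.exp (-((r k * e) * x)) := by
    funext x
    rw [egf_mixture hβ hr0 hr1]
    refine tsum_congr fun k => ?_
    congr 2
    ring
  have hmeas := hcont.aestronglyMeasurable (μ := volume.restrict (Ioi 0))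
  rw [heq] at hmeas ⊢
  refine integrable_tsum_of_summable_integral_norm
    (fun k => (integrableOn_exp_neg_mul_Ioi (hre k)).const_mul _) ?_ hmeas
  refine (hβ.mul_right (1 / e.re)).congr fun k => ?_
  simp only [norm_mul]
  rw [integral_const_mul, integral_norm_exp_neg_mul_Ioi (hre k), Complex.norm_real,
    Real.norm_of_nonneg (hr0 k).le, Complex.re_ofReal_mul]
  have := (hr0 k).ne'
  field_simp

theorem integrableOn_egf_mixture (hβ : Summable fun k => ‖β k‖) (hr0 : ∀ k, 0 < r k)
    (hr1 : ∀ k, r k ≤ 1) :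
    IntegrableOn (fun y : ℝ =>
      egf (fun n => ∑' k, β k * (r k : ℂ) ^ (n + 1)) (-(y : ℂ))) (Ioi 1) := by
  have h := integrableOn_egf_mixture_ray hβ hr0 hr1 (e := 1) (by simp)
  simp only [mul_one] at h
  exact h.mono_set (Ioi_subset_Ioi zero_le_one)

/-- Each exponential contributes a Gamma integral Γ(-s) r_kˢ. Sum and integral commute because r_k ·
r_k^(Re s) ≤ 1 for Re s > -1. -/
theorem differintegral_egf_mixture_strip (hβ : Summable fun k => ‖β k‖) (hr0 : ∀ k, 0 < r k)
    (hr1 : ∀ k, r k ≤ 1) {s : ℂ} (h1 : -1 < s.re) (h0 : s.re < 0) :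
    differintegral (egf fun n => ∑' k, β k * (r k : ℂ) ^ (n + 1)) s
      = ∑' k, β k * (r k : ℂ) ^ (s + 1) := by
  have hM := norm_tsum_mixture_le hβ hr0 hr1
  have hs : ∀ m : ℕ, s ≠ m := by
    rintro m rfl
    simp at h0
    linarith [(m.cast_nonneg : (0 : ℝ) ≤ m)]
  have hΓ : Complex.Gamma (-s) ≠ 0 := Complex.Gamma_ne_zero_of_re_pos (by simpa using h0)
  rw [differintegral_egf hM hs, mellinCont_eq_integral hM (integrableOn_egf_mixture hβ hr0 hr1) h1 h0]
  set F : ℕ → ℝ → ℂ := fun k y =>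
    (β k * r k) * ((y : ℂ) ^ (-s - 1) * Complex.exp (-(r k * y)))
  have hs0 : 0 < (-s).re := by simpa using h0
  have hFn : ∀ k, ∀ y ∈ Ioi (0 : ℝ), ‖F k y‖
      = (‖β k‖ * r k) * (y ^ ((-s).re - 1) * Real.exp (-(r k * y))) := by
    intro k y hy
    simp only [F]
    rw [norm_mul, norm_mul, norm_mul, Complex.norm_real, Real.norm_of_nonneg (hr0 k).le,
      Complex.norm_cpow_eq_rpow_re_of_pos hy, Complex.norm_exp]
    simp
  have hFni : ∀ k, ∫ y in Ioi (0 : ℝ), ‖F k y‖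
      = (‖β k‖ * r k) * ((1 / r k) ^ (-s).re * Real.Gamma (-s).re) := by
    intro k
    rw [setIntegral_congr_fun measurableSet_Ioi (hFn k), integral_const_mul,
      Real.integral_rpow_mul_exp_neg_mul_Ioi hs0 (hr0 k)]
  have hFv : ∀ k, ∫ y in Ioi (0 : ℝ), F k y
      = Complex.Gamma (-s) * (β k * (r k : ℂ) ^ (s + 1)) := by
    intro k
    have hrk : (r k : ℂ) ≠ 0 := by exact_mod_cast (hr0 k).ne'
    simp only [F]
    rw [integral_const_mul, Complex.integral_cpow_mul_exp_neg_mul_Ioi hs0 (hr0 k), one_div,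
      Complex.inv_cpow _ _ (by
        rw [Complex.arg_ofReal_of_nonneg (hr0 k).le]
        exact Real.pi_pos.ne),
      Complex.cpow_neg, inv_inv, Complex.cpow_add _ _ hrk, Complex.cpow_one]
    ring
  have hFi : ∀ k, IntegrableOn (F k) (Ioi 0) := by
    intro k
    have hr : IntegrableOn (fun y : ℝ => y ^ ((-s).re - 1) * Real.exp (-(r k * y))) (Ioi 0) := by
      -- A non-integrable function has integral 0 by convention, so the nonzero Gamma value proves
      -- integrability.
      refine not_imp_comm.1 integral_undef ?_
      rw [Real.integral_rpow_mul_exp_neg_mul_Ioi hs0 (hr0 k)]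
      have := Real.Gamma_pos_of_pos hs0
      have := hr0 k
      positivity
    refine Integrable.mono' (hr.const_mul (‖β k‖ * r k)) ?_ ?_
    · exact aestronglyMeasurable_mul_cpow measurableSet_Ioi (fun y hy => hy)
        (f := fun _ => β k * r k) continuous_const (fun y => Complex.exp (-(r k * y)))
        (Continuous.continuousOn (by fun_prop)) (-s - 1)
    · filter_upwards [ae_restrict_mem measurableSet_Ioi] with y hy
      exact (hFn k y hy).le
  have hsum : Summable fun k => ∫ y in Ioi (0 : ℝ), ‖F k y‖ := by
    refine Summable.of_nonneg_of_le (fun k => by positivity) (fun k => ?_)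
      (hβ.mul_right (Real.Gamma (-s).re))
    rw [hFni, mul_assoc, ← mul_assoc (r k)]
    refine mul_le_mul_of_nonneg_left ?_ (norm_nonneg _)
    refine mul_le_of_le_one_left (Real.Gamma_pos_of_pos hs0).le ?_
    rw [one_div, Real.inv_rpow (hr0 k).le, ← Real.rpow_neg (hr0 k).le]
    nth_rewrite 1 [← Real.rpow_one (r k)]
    rw [← Real.rpow_add (hr0 k)]
    refine Real.rpow_le_one (hr0 k).le (hr1 k) ?_
    simp
    linarith
  have hH := hasSum_integral_of_summable_integral_norm hFi hsum
  have hpt : ∀ y ∈ Ioi (0 : ℝ), egf (fun n => ∑' k, β k * (r k : ℂ) ^ (n + 1)) (-(y : ℂ)) *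
      (y : ℂ) ^ (-s - 1) = ∑' k, F k y := by
    intro y _
    rw [egf_mixture hβ hr0 hr1, ← tsum_mul_right]
    refine tsum_congr fun k => ?_
    simp only [F]
    rw [mul_neg]
    ring
  rw [setIntegral_congr_fun measurableSet_Ioi hpt, ← hH.tsum_eq, tsum_congr hFv, tsum_mul_left,
    inv_mul_cancel_left₀ hΓ]

theorem differentiableOn_tsum_mixture_cpow (hβ : Summable fun k => ‖β k‖) (hr0 : ∀ k, 0 < r k)
    (hr1 : ∀ k, r k ≤ 1) :
    DifferentiableOn ℂ (fun s : ℂ => ∑' k, β k * (r k : ℂ) ^ (s + 1)) {s | -1 < s.re} := by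
  refine Complex.differentiableOn_tsum_of_summable_norm hβ (fun k => ?_)
    (isOpen_lt continuous_const Complex.continuous_re) fun k s hs => ?_
  · have hrk : (r k : ℂ) ≠ 0 := by exact_mod_cast (hr0 k).ne'
    refine Differentiable.differentiableOn (Differentiable.const_mul ?_ _)
    exact (differentiable_id.add_const (1 : ℂ)).const_cpow (Or.inl hrk)
  · rw [norm_mul, Complex.norm_cpow_eq_rpow_re_of_pos (hr0 k)]
    refine mul_le_of_le_one_right (norm_nonneg _) (Real.rpow_le_one (hr0 k).le (hr1 k) ?_)
    have : -1 < s.re := hs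
    simp
    linarith

/-- The identity theorem carries the formula from the strip to the half-plane without ℕ; the
integers follow from the definition. -/
theorem differintegral_egf_mixture (hβ : Summable fun k => ‖β k‖) (hr0 : ∀ k, 0 < r k)
    (hr1 : ∀ k, r k ≤ 1) {s : ℂ} (hs : -1 < s.re) :
    differintegral (egf fun n => ∑' k, β k * (r k : ℂ) ^ (n + 1)) s
      = ∑' k, β k * (r k : ℂ) ^ (s + 1) := by
  have hM := norm_tsum_mixture_le hβ hr0 hr1
  by_cases hm : ∃ m : ℕ, s = m
  · obtain ⟨m, rfl⟩ := hm
    rw [differintegral_egf_natCast hM]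
    refine tsum_congr fun k => ?_
    rw [← Complex.cpow_natCast]
    push_cast
    rfl
  push Not at hm
  have hopen := isOpen_halfPlane_diff_natCast
  have hA1 : AnalyticOnNhd ℂ (differintegral (egf fun n => ∑' k, β k * (r k : ℂ) ^ (n + 1)))
      {s : ℂ | -1 < s.re ∧ ∀ m : ℕ, s ≠ m} :=
    DifferentiableOn.analyticOnNhd (fun t ht => (differentiableAt_differintegral_egf hM
      (integrableOn_egf_mixture hβ hr0 hr1) ht.2 ht.1).differentiableWithinAt) hopen
  have hA2 : AnalyticOnNhd ℂ (fun s : ℂ => ∑' k, β k * (r k : ℂ) ^ (s + 1))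
      {s : ℂ | -1 < s.re ∧ ∀ m : ℕ, s ≠ m} :=
    DifferentiableOn.analyticOnNhd ((differentiableOn_tsum_mixture_cpow hβ hr0 hr1).mono
      fun t ht => ht.1) hopen
  have hstrip : {s : ℂ | -1 < s.re} ∩ {s : ℂ | s.re < 0} ∈ 𝓝 (-(1 / 2) : ℂ) :=
    ((isOpen_lt continuous_const Complex.continuous_re).inter
      (isOpen_lt Complex.continuous_re continuous_const)).mem_nhds (by
        constructor <;> norm_num)
  refine hA1.eqOn_of_preconnected_of_eventuallyEq hA2 isPreconnected_halfPlane_diff_natCast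
    (z₀ := -(1 / 2)) ⟨by norm_num, fun m h => ?_⟩ ?_ ⟨hs, hm⟩
  · have := congrArg Complex.re h
    norm_num at this
    linarith [(m.cast_nonneg : (0 : ℝ) ≤ m)]
  · filter_upwards [hstrip] with t ht
    exact differintegral_egf_mixture_strip hβ hr0 hr1 ht.1 ht.2

end Mixture

/-! ### Koenigs linearization. -/

theorem AnalyticAt.exists_quadratic_bound {φ : ℂ → ℂ} {x₀ : ℂ} (hφ : AnalyticAt ℂ φ x₀) :
    ∃ K > 0, ∀ᶠ x in 𝓝 x₀, ‖φ x - φ x₀ - deriv φ x₀ * (x - x₀)‖ ≤ K * ‖x - x₀‖ ^ 2 := by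
  obtain ⟨p, hp⟩ := hφ
  obtain ⟨K, hK0, hK⟩ := (hp.isBigO_sub_partialSum_pow 2).exists_pos
  refine ⟨K, hK0, ?_⟩
  have hK' := hK.bound
  have ht : Tendsto (fun x => x - x₀) (𝓝 x₀) (𝓝 0) := by
    have : Continuous fun x : ℂ => x - x₀ := by fun_prop
    simpa using this.tendsto x₀
  filter_upwards [ht.eventually hK'] with x hx
  have h0 : (p 0 fun _ => x - x₀) = φ x₀ := hp.coeff_zero _
  have h1 : (p 1 fun _ => x - x₀) = deriv φ x₀ * (x - x₀) := by
    rw [p.apply_eq_pow_smul_coeff, hp.deriv, FormalMultilinearSeries.coeff, pow_one, smul_eq_mul,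
      mul_comm]
    rfl
  simp only [FormalMultilinearSeries.partialSum, Finset.sum_range_succ, Finset.sum_range_zero,
    zero_add, h0, h1, add_sub_cancel, norm_pow, norm_norm] at hx
  rwa [sub_sub]

/-- Koenigs linearization at an attracting fixed point. -/
theorem exists_koenigs {φ : ℂ → ℂ} {x₀ : ℂ} (hφ : AnalyticAt ℂ φ x₀) (hfix : φ x₀ = x₀)
    {l : ℝ} (hl0 : 0 < l) (hl1 : l < 1) (hmult : deriv φ x₀ = (l : ℂ)) :
    ∃ Ψ : ℂ → ℂ, AnalyticAt ℂ Ψ x₀ ∧ Ψ x₀ = 0 ∧ deriv Ψ x₀ = 1 ∧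
      ∀ᶠ x in 𝓝 x₀, Ψ (φ x) = l * Ψ x := by
  obtain ⟨K, hK0, hK⟩ := hφ.exists_quadratic_bound
  rw [hfix, hmult] at hK
  have hsq : √l * √l = l := Real.mul_self_sqrt hl0.le
  have hs0 : 0 < √l := Real.sqrt_pos.2 hl0
  have hs1 : √l < 1 := by nlinarith
  -- A contraction rate μ > l holds near the fixed point, and μ² < l makes the quadratic errors
  -- μ^(2n)/lⁿ summable.
  obtain ⟨μ, hlμ, hμ⟩ : ∃ μ, l < μ ∧ μ < √l := exists_between (by nlinarith)
  have hμ0 : 0 < μ := hl0.trans hlμ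
  have hμ1 : μ < 1 := hμ.trans hs1
  have hq : μ ^ 2 / l < 1 := by
    rw [div_lt_one hl0]
    nlinarith
  obtain ⟨δ₁, hδ₁, hball⟩ := Metric.eventually_nhds_iff_ball.1 (hK.and hφ.eventually_analyticAt)
  set δ : ℝ := min δ₁ ((μ - l) / K)
  have hδ : 0 < δ := lt_min hδ₁ (div_pos (by linarith) hK0)
  set B := Metric.ball x₀ δ
  have hB : ∀ x ∈ B, ‖φ x - x₀ - l * (x - x₀)‖ ≤ K * ‖x - x₀‖ ^ 2 := fun x hx =>
    (hball x (Metric.ball_subset_ball (min_le_left _ _) hx)).1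
  have hdiff : DifferentiableOn ℂ φ B := fun x hx =>
    (hball x (Metric.ball_subset_ball (min_le_left _ _) hx)).2.differentiableAt.differentiableWithinAt
  have hcontr : ∀ x ∈ B, ‖φ x - x₀‖ ≤ μ * ‖x - x₀‖ := by
    intro x hx
    have h1 : ‖x - x₀‖ ≤ (μ - l) / K := (mem_ball_iff_norm.1 hx).le.trans (min_le_right _ _)
    rw [le_div_iff₀ hK0] at h1
    have h2 := norm_add_le (φ x - x₀ - l * (x - x₀)) (l * (x - x₀))
    rw [sub_add_cancel, norm_mul, Complex.norm_real, Real.norm_of_nonneg hl0.le] at h2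
    nlinarith [hB x hx, norm_nonneg (x - x₀)]
  have hmaps : MapsTo φ B B := by
    intro x hx
    rw [mem_ball_iff_norm] at hx ⊢
    have := hcontr x (mem_ball_iff_norm.2 hx)
    nlinarith [norm_nonneg (x - x₀)]
  have hiter : ∀ n : ℕ, ∀ x ∈ B, ‖φ^[n] x - x₀‖ ≤ μ ^ n * ‖x - x₀‖ := by
    intro n x hx
    induction n with
    | zero => simp
    | succ n ih =>
      rw [Function.iterate_succ_apply', pow_succ', mul_assoc]
      exact (hcontr _ (hmaps.iterate n hx)).trans (mul_le_mul_of_nonneg_left ih hμ0.le)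
  have hlC : (l : ℂ) ≠ 0 := by exact_mod_cast hl0.ne'
  -- The successive differences of l^(-n) (φⁿ(x) - x₀): the Koenigs limit is written as a
  -- telescoping series.
  set T : ℕ → ℂ → ℂ := fun n x => ((l : ℂ) ^ (n + 1))⁻¹ * (φ (φ^[n] x) - x₀ - l * (φ^[n] x - x₀))
  have hT : ∀ n, ∀ x ∈ B, ‖T n x‖ ≤ K / l * (μ ^ 2 / l) ^ n * ‖x - x₀‖ ^ 2 := by
    intro n x hx
    have h1 := hB _ (hmaps.iterate n hx)
    have h2 : ‖φ^[n] x - x₀‖ ^ 2 ≤ (μ ^ n * ‖x - x₀‖) ^ 2 := by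
      gcongr
      exact hiter n x hx
    simp only [T]
    rw [norm_mul, norm_inv, norm_pow, Complex.norm_real, Real.norm_of_nonneg hl0.le]
    calc (l ^ (n + 1))⁻¹ * ‖φ (φ^[n] x) - x₀ - l * (φ^[n] x - x₀)‖
        ≤ (l ^ (n + 1))⁻¹ * (K * (μ ^ n * ‖x - x₀‖) ^ 2) := by
          gcongr
          exact h1.trans (by gcongr)
      _ = K / l * (μ ^ 2 / l) ^ n * ‖x - x₀‖ ^ 2 := by
          rw [div_pow, pow_succ]
          field_simp
          ring
  have hgeo : Summable fun n : ℕ => K / l * (μ ^ 2 / l) ^ n :=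
    (summable_geometric_of_lt_one (by positivity) hq).mul_left _
  have hTs : ∀ x ∈ B, Summable fun n => T n x := fun x hx =>
    Summable.of_norm_bounded (hgeo.mul_right _) fun n => hT n x hx
  have hTd : DifferentiableOn ℂ (fun x => ∑' n, T n x) B := by
    refine Complex.differentiableOn_tsum_of_summable_norm (hgeo.mul_right (δ ^ 2)) (fun n => ?_)
      Metric.isOpen_ball fun n x hx => (hT n x hx).trans ?_
    · have h1 := hdiff.iterate hmaps n
      have h2 := hdiff.comp h1 (hmaps.iterate n)
      exact ((h2.sub_const _).sub ((h1.sub_const _).const_mul _)).const_mul _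
    · have := (mem_ball_iff_norm.1 hx).le
      gcongr
  have hBn : B ∈ 𝓝 x₀ := Metric.ball_mem_nhds x₀ hδ
  have hT0 : HasDerivAt (fun x => ∑' n, T n x) 0 x₀ := by
    have hO : (fun x => ∑' n, T n x) =O[𝓝 x₀] fun x => ‖x - x₀‖ ^ 2 := by
      refine Asymptotics.IsBigO.of_bound (∑' n, K / l * (μ ^ 2 / l) ^ n) ?_
      filter_upwards [hBn] with x hx
      rw [norm_pow, norm_norm, ← tsum_mul_right]
      exact tsum_of_norm_bounded (hgeo.mul_right _).hasSum fun n => hT n x hx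
    have h := hO.hasFDerivAt (𝕜 := ℂ) one_lt_two
    rw [hasDerivAt_iff_hasFDerivAt]
    convert! h using 1
    ext
    simp
  have hΨd : HasDerivAt (fun x => (x - x₀) + ∑' n, T n x) 1 x₀ := by
    simpa using! ((hasDerivAt_id x₀).sub_const x₀).add hT0
  refine ⟨fun x => (x - x₀) + ∑' n, T n x, ?_, ?_, hΨd.deriv, ?_⟩
  · exact ((differentiableOn_id.sub_const x₀).add hTd).analyticAt hBn
  · have : ∀ n, T n x₀ = 0 := fun n => by
      have := hT n x₀ (Metric.mem_ball_self hδ)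
      simpa using this
    simp [this]
  · filter_upwards [hBn] with x hx
    have h1 : ∀ n, T n (φ x) = l * T (n + 1) x := by
      intro n
      simp only [T]
      rw [← Function.iterate_succ_apply, pow_succ (l : ℂ) (n + 1), mul_inv]
      field_simp
    have h2 : (l : ℂ) * T 0 x = φ x - x₀ - l * (x - x₀) := by
      simp [T, hlC]
    simp only [h1, tsum_mul_left]
    rw [(hTs x hx).tsum_eq_zero_add, mul_add, mul_add, h2]
    ring

/-- The inverse of the Koenigs map on a small disc. -/
theorem exists_koenigs_parametrization {φ : ℂ → ℂ} {x₀ : ℂ} (hφ : AnalyticAt ℂ φ x₀)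
    (hfix : φ x₀ = x₀) {l : ℝ} (hl0 : 0 < l) (hl1 : l < 1) (hmult : deriv φ x₀ = (l : ℂ))
    {U : Set ℂ} (hU : U ∈ 𝓝 x₀) :
    ∃ h : ℂ → ℂ, ∃ R > 0, DifferentiableOn ℂ h (Metric.ball 0 R) ∧ h 0 = x₀ ∧
      InjOn h (Metric.ball 0 R) ∧ MapsTo h (Metric.ball 0 R) U ∧
      (∀ u ∈ Metric.ball 0 R, φ (h u) = h (l * u)) ∧ h '' Metric.ball 0 R ∈ 𝓝 x₀ := by
  obtain ⟨Ψ, hΨ, hΨ0, hΨ1, hfun⟩ := exists_koenigs hφ hfix hl0 hl1 hmult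
  have hne : deriv Ψ x₀ ≠ 0 := by simp [hΨ1]
  set h := hΨ.hasStrictDerivAt.localInverse _ _ _ hne
  have hh : AnalyticAt ℂ h 0 := hΨ0 ▸ hΨ.analyticAt_localInverse hne
  have hr : ∀ᶠ u in 𝓝 0, Ψ (h u) = u := by
    have := hΨ.hasStrictDerivAt.eventually_right_inverse hne
    rwa [hΨ0] at this
  have hl : ∀ᶠ x in 𝓝 x₀, h (Ψ x) = x := hΨ.hasStrictDerivAt.eventually_left_inverse hne
  have h0 : h 0 = x₀ := hΨ0 ▸ hl.self_of_nhds
  have hht : Tendsto h (𝓝 0) (𝓝 x₀) := h0 ▸ hh.continuousAt.tendsto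
  have hφt : Tendsto φ (𝓝 x₀) (𝓝 x₀) := by
    have := hφ.continuousAt.tendsto
    rwa [hfix] at this
  have hconj : ∀ᶠ u in 𝓝 0, φ (h u) = h (l * u) := by
    filter_upwards [hr, hht.eventually hfun, (hφt.comp hht).eventually hl] with u h1 h2 h3
    rw [h1] at h2
    rw [← h2]
    exact h3.symm
  obtain ⟨R, hR, hball⟩ := Metric.eventually_nhds_iff_ball.1
    ((hr.and hconj).and (hh.eventually_analyticAt.and (hht.eventually hU)))
  refine ⟨h, R, hR, fun u hu => (hball u hu).2.1.differentiableAt.differentiableWithinAt, h0, ?_,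
    fun u hu => (hball u hu).2.2, fun u hu => (hball u hu).1.2, ?_⟩
  · intro u hu v hv huv
    rw [← (hball u hu).1.1, ← (hball v hv).1.1, huv]
  · have hΨt : Tendsto Ψ (𝓝 x₀) (𝓝 0) := by
      have := hΨ.continuousAt.tendsto
      rwa [hΨ0] at this
    filter_upwards [hl, hΨt.eventually (Metric.ball_mem_nhds 0 hR)] with x h1 h2
    exact ⟨Ψ x, h2, h1⟩

/-! ### Fractional iteration in the linearizing coordinate. -/

theorem ofReal_pow_cpow {l : ℝ} (hl : 0 ≤ l) (k : ℕ) (z : ℂ) :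
    ((l ^ k : ℝ) : ℂ) ^ z = ((l : ℂ) ^ z) ^ k := by
  induction k with
  | zero => simp
  | succ k ih =>
    rw [pow_succ, Complex.ofReal_mul, Complex.mul_cpow_ofReal_nonneg (pow_nonneg hl k) hl, ih,
      pow_succ]

section Parametrization

variable {φ h : ℂ → ℂ} {l R : ℝ} {c : ℂ}

theorem ofReal_cpow_mul_mem_ball (hl0 : 0 < l) (hl1 : l < 1) (hc : c ∈ Metric.ball 0 R) {z : ℂ}
    (hz : 0 ≤ z.re) : (l : ℂ) ^ z * c ∈ Metric.ball 0 R := by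
  rw [mem_ball_zero_iff] at hc ⊢
  refine lt_of_le_of_lt ?_ hc
  rw [norm_mul, Complex.norm_cpow_eq_rpow_re_of_pos hl0]
  exact mul_le_of_le_one_left (norm_nonneg _) (Real.rpow_le_one hl0.le hl1.le hz)

theorem ofReal_pow_mul_mem_ball (hl0 : 0 < l) (hl1 : l < 1) (hc : c ∈ Metric.ball 0 R) (n : ℕ) :
    (l : ℂ) ^ n * c ∈ Metric.ball 0 R := by
  simpa using ofReal_cpow_mul_mem_ball hl0 hl1 hc (z := n) (by simp)

theorem iterate_parametrization (hl0 : 0 < l) (hl1 : l < 1)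
    (hconj : ∀ u ∈ Metric.ball 0 R, φ (h u) = h (l * u)) (hc : c ∈ Metric.ball 0 R) (n : ℕ) :
    φ^[n] (h c) = h ((l : ℂ) ^ n * c) := by
  induction n with
  | zero => simp
  | succ n ih =>
    rw [Function.iterate_succ_apply', ih, hconj _ (ofReal_pow_mul_mem_ball hl0 hl1 hc n), pow_succ',
      mul_assoc]

/-- In the linearizing coordinate, the orbit is an exponential mixture. -/
theorem exists_mixture (hl0 : 0 < l) (hl1 : l < 1)
    (hd : DifferentiableOn ℂ h (Metric.ball 0 R))
    (hconj : ∀ u ∈ Metric.ball 0 R, φ (h u) = h (l * u)) (hc : c ∈ Metric.ball 0 R) :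
    ∃ β : ℕ → ℂ, (Summable fun k => ‖β k‖) ∧
      (∀ n : ℕ, φ^[n + 1] (h c) = ∑' k, β k * ((l ^ k : ℝ) : ℂ) ^ (n + 1)) ∧
      ∀ z : ℂ, 0 ≤ z.re → h ((l : ℂ) ^ z * c) = ∑' k, β k * ((l ^ k : ℝ) : ℂ) ^ z := by
  -- Taylor coefficients at 0 of v ↦ h(vc), to be evaluated at v = 1, lⁿ and lᶻ.
  set β : ℕ → ℂ := fun k => (k.factorial : ℂ)⁻¹ * c ^ k * iteratedDeriv k h 0
  have hsum : ∀ v : ℂ, v * c ∈ Metric.ball 0 R → HasSum (fun k => β k * v ^ k) (h (v * c)) := by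
    intro v hv
    convert! Complex.hasSum_taylorSeries_on_ball hd hv using 2 with k
    simp only [β, smul_eq_mul, sub_zero, mul_pow]
    ring
  refine ⟨β, ?_, fun n => ?_, fun z hz => ?_⟩
  · simpa using (hsum 1 (by simpa using hc)).summable.norm
  · rw [iterate_parametrization hl0 hl1 hconj hc,
      ← (hsum _ (ofReal_pow_mul_mem_ball hl0 hl1 hc (n + 1))).tsum_eq]
    refine tsum_congr fun k => ?_
    rw [Complex.ofReal_pow, ← pow_mul, ← pow_mul, mul_comm k]
  · rw [← (hsum _ (ofReal_cpow_mul_mem_ball hl0 hl1 hc hz)).tsum_eq]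
    exact tsum_congr fun k => by rw [ofReal_pow_cpow hl0.le]

theorem integrableOn_iterTheta_ray (hl0 : 0 < l) (hl1 : l < 1)
    (hd : DifferentiableOn ℂ h (Metric.ball 0 R))
    (hconj : ∀ u ∈ Metric.ball 0 R, φ (h u) = h (l * u)) (hc : c ∈ Metric.ball 0 R) {e : ℂ}
    (he : 0 < e.re) :
    IntegrableOn (fun x : ℝ => iterTheta φ (h c) (-((x : ℂ) * e))) (Ioi 0) := by
  obtain ⟨β, hβ, hn, -⟩ := exists_mixture hl0 hl1 hd hconj hc
  have h1 := integrableOn_egf_mixture_ray hβ (fun k => pow_pos hl0 k)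
    (fun k => pow_le_one₀ hl0.le hl1.le) he
  simp only [← hn] at h1
  exact h1

theorem fracIter_parametrization (hl0 : 0 < l) (hl1 : l < 1)
    (hd : DifferentiableOn ℂ h (Metric.ball 0 R))
    (hconj : ∀ u ∈ Metric.ball 0 R, φ (h u) = h (l * u)) (hc : c ∈ Metric.ball 0 R) {z : ℂ}
    (hz : 0 < z.re) :
    fracIter φ z (h c) = h ((l : ℂ) ^ z * c) := by
  obtain ⟨β, hβ, hn, hz'⟩ := exists_mixture hl0 hl1 hd hconj hc
  have h1 := differintegral_egf_mixture hβ (fun k => pow_pos hl0 k)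
    (fun k => pow_le_one₀ hl0.le hl1.le) (s := z - 1) (by simpa using hz)
  simp only [← hn, sub_add_cancel] at h1
  rw [hz' z hz.le, ← h1]
  rfl

theorem tendsto_iterate_parametrization (hl0 : 0 < l) (hl1 : l < 1)
    (hd : DifferentiableOn ℂ h (Metric.ball 0 R))
    (hconj : ∀ u ∈ Metric.ball 0 R, φ (h u) = h (l * u)) (hc : c ∈ Metric.ball 0 R) :
    Tendsto (fun n : ℕ => φ^[n] (h c)) atTop (𝓝 (h 0)) := by
  simp only [iterate_parametrization hl0 hl1 hconj hc]
  have hR : 0 < R := (norm_nonneg c).trans_lt (mem_ball_zero_iff.1 hc)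
  have hcont : ContinuousAt h 0 :=
    (hd.differentiableAt (Metric.ball_mem_nhds 0 hR)).continuousAt
  refine hcont.tendsto.comp ?_
  have := (tendsto_pow_atTop_nhds_zero_of_norm_lt_one (x := (l : ℂ))
    (by rwa [Complex.norm_real, Real.norm_of_nonneg hl0.le])).mul_const c
  simpa using this

theorem image_ball_subset_immediateBasin {G : Set ℂ} (hR : 0 < R) (hl0 : 0 < l) (hl1 : l < 1)
    (hd : DifferentiableOn ℂ h (Metric.ball 0 R)) (hG : MapsTo h (Metric.ball 0 R) G)
    (hconj : ∀ u ∈ Metric.ball 0 R, φ (h u) = h (l * u)) :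
    h '' Metric.ball 0 R ⊆ immediateBasin G φ (h 0) := by
  refine ((convex_ball (0 : ℂ) R).isPreconnected.image h
    hd.continuousOn).subset_connectedComponentIn ⟨0, Metric.mem_ball_self hR, rfl⟩ ?_
  rintro _ ⟨c, hc, rfl⟩
  exact ⟨hG hc, tendsto_iterate_parametrization hl0 hl1 hd hconj hc⟩

end Parametrization

/-! ### The functional equation and injectivity. -/

/-- Equality of the powers means (z - w) log l = 2πin, and the bound on the imaginary parts leaves
only n = 0. -/
theorem eq_of_ofReal_cpow_eq {l : ℝ} (hl0 : 0 < l) (hl1 : l < 1) {z w : ℂ}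
    (h : (l : ℂ) ^ z = (l : ℂ) ^ w) (him : |z.im - w.im| < 2 * Real.pi / |Real.log l|) : z = w := by
  have hlC : (l : ℂ) ≠ 0 := by exact_mod_cast hl0.ne'
  have hlog : Real.log l ≠ 0 := (Real.log_neg hl0 hl1).ne
  rw [Complex.cpow_def_of_ne_zero hlC, Complex.cpow_def_of_ne_zero hlC,
    ← Complex.ofReal_log hl0.le, Complex.exp_eq_exp_iff_exists_int] at h
  obtain ⟨n, hn⟩ := h
  have h1 := congrArg Complex.re hn
  have h2 := congrArg Complex.im hn
  simp at h1 h2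
  have h3 : Real.log l * (z.im - w.im) = n * (2 * Real.pi) := by linear_combination h2
  have hn0 : n = 0 := by
    rw [lt_div_iff₀ (abs_pos.2 hlog), mul_comm, ← abs_mul, h3, abs_mul,
      abs_of_pos Real.two_pi_pos] at him
    have h4 : |(n : ℝ)| < 1 := by
      by_contra! h5
      nlinarith [Real.two_pi_pos]
    have h5 : |n| < 1 := by exact_mod_cast h4
    exact Int.abs_lt_one_iff.1 h5
  rw [hn0, Int.cast_zero, zero_mul] at h3
  refine Complex.ext ?_ (sub_eq_zero.1 ((mul_eq_zero.1 h3).resolve_left hlog))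
  rcases h1 with h1 | h1
  · exact h1
  · rcases h1 with h1 | h1 | h1 <;> linarith

/-- Iteration of `φ` translates the argument of the fractional iterates. -/
theorem fracIter_add_natCast {G : Set ℂ} (hG : IsOpen G) {φ : ℂ → ℂ}
    (hφ : DifferentiableOn ℂ φ G) {ξ ξ₀ : ℂ} (hξ : ξ ∈ fracIterDomain G φ ξ₀)
    {h : ℂ → ℂ} {l R : ℝ} (hl0 : 0 < l) (hl1 : l < 1)
    (hd : DifferentiableOn ℂ h (Metric.ball 0 R))
    (hconj : ∀ u ∈ Metric.ball 0 R, φ (h u) = h (l * u))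
    {N : ℕ} {C : ℂ} (hC : C ∈ Metric.ball 0 R) (hN : h C = φ^[N] ξ) :
    (∀ z : ℂ, 0 < z.re → fracIter φ (z + N) ξ = h ((l : ℂ) ^ z * C)) ∧
    ∀ z : ℂ, 0 < z.re → ∀ n : ℕ, fracIter φ (z + n) ξ = φ^[n] (fracIter φ z ξ) := by
  obtain ⟨hξA, ⟨θ, hθ, -, hint⟩, hmem⟩ := hξ
  have hAG : immediateBasin G φ ξ₀ ⊆ G := fun x hx =>
    (connectedComponentIn_subset _ _ hx).1
  have hlim : Tendsto (fun n : ℕ => φ^[n] ξ) atTop (𝓝 ξ₀) :=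
    (connectedComponentIn_subset _ _ hξA).2
  set a : ℕ → ℂ := fun n => φ^[n + 1] ξ
  obtain ⟨M, hM⟩ : ∃ M, ∀ n, ‖a n‖ ≤ M := by
    obtain ⟨M, hM⟩ := (Metric.isBounded_range_of_tendsto _ hlim).exists_norm_le
    exact ⟨M, fun n => hM _ ⟨n + 1, rfl⟩⟩
  have hfrac : ∀ z, fracIter φ z ξ = differintegral (egf a) (z - 1) := fun z => rfl
  have haN : (fun n => a (n + N)) = fun n => φ^[n + 1] (h C) := by
    funext n
    simp only [a]
    rw [hN, ← Function.iterate_add_apply, add_right_comm]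
  have h1 : ∀ z : ℂ, 0 < z.re → fracIter φ (z + N) ξ = h ((l : ℂ) ^ z * C) := by
    intro z hz
    have hshift := differintegral_egf_add_natCast hM N (s := z - 1) (by
      rw [haN]
      have := integrableOn_iterTheta_ray hl0 hl1 hd hconj hC (e := 1) (by simp)
      simp only [mul_one] at this
      exact this.mono_set (Ioi_subset_Ioi zero_le_one)) (by simpa using hz)
    rw [hfrac, show z + N - 1 = z - 1 + N by ring, hshift, haN]
    exact fracIter_parametrization hl0 hl1 hd hconj hC hz
  refine ⟨h1, ?_⟩
  have hint1 : IntegrableOn (fun y : ℝ => egf a (-(y : ℂ))) (Ioi 1) := by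
    have := hint 0 (by simpa using hθ)
    simp only [Complex.ofReal_zero, zero_mul, Complex.exp_zero, mul_one] at this
    exact this.mono_set (Ioi_subset_Ioi zero_le_one)
  have hstep : ∀ s : ℂ, -1 < s.re →
      differintegral (egf a) (s + 1) = φ (differintegral (egf a) s) := by
    intro s hs
    by_cases hm : ∃ m : ℕ, s = m
    · obtain ⟨m, rfl⟩ := hm
      rw [← Nat.cast_succ, differintegral_egf_natCast hM, differintegral_egf_natCast hM]
      exact Function.iterate_succ_apply' φ (m + 1) ξ
    push Not at hm
    have hopen := isOpen_halfPlane_diff_natCast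
    have hA1 : AnalyticOnNhd ℂ (fun s => differintegral (egf a) (s + 1))
        {s : ℂ | -1 < s.re ∧ ∀ m : ℕ, s ≠ m} := by
      refine DifferentiableOn.analyticOnNhd (fun t ht => ?_) hopen
      have hd1 := differentiableAt_differintegral_egf hM hint1 (s := t + 1) ?_
        (by have := ht.1; simp; linarith)
      · exact (hd1.comp t (differentiableAt_id.add_const (1 : ℂ))).differentiableWithinAt
      · rintro (_ | m) hm
        · have h2 := congrArg Complex.re hm
          have h3 := ht.1
          simp at h2
          linarith
        · apply ht.2 m
          push_cast at hm
          linear_combination hm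
    have hA2 : AnalyticOnNhd ℂ (fun s => φ (differintegral (egf a) s))
        {s : ℂ | -1 < s.re ∧ ∀ m : ℕ, s ≠ m} := by
      refine DifferentiableOn.analyticOnNhd (fun t ht => ?_) hopen
      have hd1 := differentiableAt_differintegral_egf hM hint1 ht.2 ht.1
      -- Order t is time t+1. The requirement that iterates remain in the immediate basin makes the
      -- composition with φ holomorphic.
      have hG1 : differintegral (egf a) t ∈ G := by
        have := hAG (hmem (t + 1) (by have := ht.1; simp; linarith))
        rwa [hfrac, add_sub_cancel_right] at this
      exact ((hφ.differentiableAt (hG.mem_nhds hG1)).comp t hd1).differentiableWithinAt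
    have hev : ∀ᶠ t : ℂ in 𝓝 ((N : ℂ) + 1 / 2), (N : ℝ) - 1 < t.re :=
      (isOpen_lt continuous_const Complex.continuous_re).mem_nhds (by
        simp
        norm_num
        linarith)
    -- The base point N + 1/2 avoids ℕ and lies in Re t > N-1, where both sides are known through h.
    refine hA1.eqOn_of_preconnected_of_eventuallyEq hA2 isPreconnected_halfPlane_diff_natCast
      (z₀ := (N : ℂ) + 1 / 2) ⟨?_, fun m hm => ?_⟩ ?_ ⟨hs, hm⟩
    · have : (0 : ℝ) ≤ N := N.cast_nonneg
      simp
      norm_num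
      linarith
    · have h2 : ((2 * N + 1 : ℕ) : ℂ) = ((2 * m : ℕ) : ℂ) := by
        push_cast
        linear_combination 2 * hm
      have h3 : 2 * N + 1 = 2 * m := by exact_mod_cast h2
      lia
    · filter_upwards [hev] with t ht
      have ht1 : 0 < (t + 1 - N).re := by
        simp
        linarith
      have e1 := h1 (t + 1 - N) ht1
      have e2 := h1 (t + 1 - N + 1) (by rw [Complex.add_re, Complex.one_re]; linarith)
      rw [hfrac, show t + 1 - N + N - 1 = t by ring] at e1
      rw [hfrac, show t + 1 - N + 1 + N - 1 = t + 1 by ring] at e2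
      rw [e1, e2, hconj _ (ofReal_cpow_mul_mem_ball hl0 hl1 hC ht1.le),
        Complex.cpow_add _ _ (by exact_mod_cast hl0.ne'), Complex.cpow_one]
      congr 1
      ring
  intro z hz n
  induction n with
  | zero => simp
  | succ n ih =>
    have h2 := hstep (z + n - 1) (by
      have : (0 : ℝ) ≤ n := n.cast_nonneg
      simp
      linarith)
    rw [Function.iterate_succ_apply', ← ih, hfrac, hfrac, ← h2]
    congr 1
    push_cast
    ring

end

theorem mainTheorem7 (G : Set ℂ) (hG : IsOpen G) (hGc : IsConnected G)
    (φ : ℂ → ℂ) (hφ : DifferentiableOn ℂ φ G) (hmaps : MapsTo φ G G)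
    (ξ₀ : ℂ) (hξ₀ : ξ₀ ∈ G) (hfix : φ ξ₀ = ξ₀)
    (l : ℝ) (hl0 : 0 < l) (hl1 : l < 1) (hmult : deriv φ ξ₀ = (l : ℂ))
    (hderiv : ∀ ξ ∈ G, deriv φ ξ ≠ 0) :
    (∀ᶠ ξ in 𝓝 ξ₀, ξ ∈ fracIterDomain G φ ξ₀) ∧
    ∀ ξ ∈ fracIterDomain G φ ξ₀, (∀ n : ℕ, φ^[n] ξ ≠ ξ₀) →
      InjOn (fun z : ℂ => fracIter φ z ξ)
        {z : ℂ | 0 < z.re ∧ 0 ≤ z.im ∧ z.im < 2 * Real.pi / |Real.log l|} := by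
  have hGn : G ∈ 𝓝 ξ₀ := hG.mem_nhds hξ₀
  obtain ⟨h, R, hR, hd, h0, hinj, hhG, hconj, himg⟩ :=
    exists_koenigs_parametrization (hφ.analyticAt hGn) hfix hl0 hl1 hmult hGn
  have hbasin := image_ball_subset_immediateBasin hR hl0 hl1 hd hhG hconj
  rw [h0] at hbasin
  constructor
  · filter_upwards [himg] with ξ hξ
    obtain ⟨c, hc, rfl⟩ := hξ
    -- For |η| < π/2 the direction exp(iη) has positive real part, so every exponential in the
    -- mixture decays along the ray.
    refine ⟨hbasin ⟨c, hc, rfl⟩, ⟨Real.pi / 2, by positivity, ?_, fun η hη => ?_⟩, fun z hz => ?_⟩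
    · obtain ⟨M, hM⟩ := (Metric.isBounded_range_of_tendsto _
        (tendsto_iterate_parametrization hl0 hl1 hd hconj hc)).exists_norm_le
      exact differentiable_egf (a := fun n => φ^[n + 1] (h c)) fun n => hM _ ⟨n + 1, rfl⟩
    · refine integrableOn_iterTheta_ray hl0 hl1 hd hconj hc ?_
      rw [Complex.exp_ofReal_mul_I_re]
      exact Real.cos_pos_of_mem_Ioo (abs_lt.1 hη)
    · rw [fracIter_parametrization hl0 hl1 hd hconj hc hz]
      exact hbasin ⟨_, ofReal_cpow_mul_mem_ball hl0 hl1 hc hz.le, rfl⟩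
  · intro ξ hξ horb z hz w hw hzw
    have hlim : Tendsto (fun n : ℕ => φ^[n] ξ) atTop (𝓝 ξ₀) :=
      (connectedComponentIn_subset _ _ hξ.1).2
    obtain ⟨N, C, hC, hN⟩ := (hlim.eventually himg).exists
    have hC0 : C ≠ 0 := by
      rintro rfl
      exact horb N (hN.symm.trans h0)
    obtain ⟨h1, h2⟩ := fracIter_add_natCast hG hφ hξ hl0 hl1 hd hconj hC hN
    -- Applying φ N times to the common value moves both times to z+N and w+N, where the formula
    -- through h is available.
    have h3 : h ((l : ℂ) ^ z * C) = h ((l : ℂ) ^ w * C) := by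
      rw [← h1 z hz.1, ← h1 w hw.1, h2 z hz.1, h2 w hw.1]
      exact congrArg _ hzw
    have h4 := hinj (ofReal_cpow_mul_mem_ball hl0 hl1 hC hz.1.le)
      (ofReal_cpow_mul_mem_ball hl0 hl1 hC hw.1.le) h3
    refine eq_of_ofReal_cpow_eq hl0 hl1 (mul_right_cancel₀ hC0 h4) ?_
    rw [abs_lt]
    constructor <;> linarith [hz.2.1, hz.2.2, hw.2.1, hw.2.2]
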